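/- For graphs $X, Y$ on the same vertex set, $X$ is a bounded extension of $Y$ if $Y$ is a subgraph of $X$ and there is a constant $M$ such that $d_Y(u,v) \le M$ for every edge $uv$ of $X$, where $d_Y$ is the graph distance in $Y$. For vertices $u, v$ of a graph $X$ and an integer $k$, the geodesic slice $S_X(u,v,k)$ is the set of vertices $w$ that lie on a geodesic (shortest path) of $X$ between $u$ and $v$ and satisfy $d_X(u,w) = k$. The graph $X$ has bounded geodesic slices if there is a constant $B$ such that $|S_X(u,v,k)| \le B$ for all vertices $u, v$ and all integers $k$. A graph $L$ is geodesically directable if there exists a bounded extension $G$ of $L$ that has bounded geodesic slices. Theorem. Let $\mathbb{Z}^2$ denote the square lattice graph, in which two points of $\mathbb{Z}\times\mathbb{Z}$ are adjacent if and only if they differ by $1$ in one coordinate and agree in the other. Every bounded extension $L$ of $\mathbb{Z}^2$ is geodesically directable. -/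

import Mathlib

namespace GeodesicSlices

universe u

/-- The square lattice: the graph on `ℤ × ℤ` in which two points are adjacent iff they differ by
one in exactly one coordinate and agree in the other. -/
def squareLattice : SimpleGraph (ℤ × ℤ) where
  Adj a b := |a.1 - b.1| + |a.2 - b.2| = 1
  symm := ⟨fun a b h => by rw [abs_sub_comm b.1, abs_sub_comm b.2]; exact h⟩
  loopless := ⟨fun a h => by simp at h⟩

/-- `X` is a bounded extension of `Y`: `Y` is a subgraph of `X` on the same vertex set, and the
distance in `Y` between the endpoints of an edge of `X` is uniformly bounded. The extended distance
is used, so that endpoints in different components of `Y` are at infinite distance. -/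
def IsBoundedExtension {V : Type u} (X Y : SimpleGraph V) : Prop :=
  Y ≤ X ∧ ∃ M : ℕ, ∀ u v : V, X.Adj u v → Y.edist u v ≤ M

/-- A geodesic between `u` and `v` is a walk whose length is the distance between `u` and `v`
(such a walk repeats no vertex). -/
def IsGeodesic {V : Type u} (X : SimpleGraph V) {u v : V} (p : X.Walk u v) : Prop :=
  p.length = X.dist u v

/-- The geodesic slice `S_X(u, v, k)`: the vertices lying on some geodesic between `u` and `v` and
having distance `k` from `u`. -/
def geodesicSlice {V : Type u} (X : SimpleGraph V) (u v : V) (k : ℤ) : Set V :=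
  {w | (∃ p : X.Walk u v, IsGeodesic X p ∧ w ∈ p.support) ∧ (X.dist u w : ℤ) = k}

/-- The cardinalities of the geodesic slices are bounded by one natural number `B`; since
`Set.encard` takes the value `⊤` on infinite sets, all slices are in particular finite. -/
def HasBoundedGeodesicSlices {V : Type u} (X : SimpleGraph V) : Prop :=
  ∃ B : ℕ, ∀ (u v : V) (k : ℤ), (geodesicSlice X u v k).encard ≤ B

/-- A graph is geodesically directable if some bounded extension of it has bounded geodesic
slices. -/
def GeodesicallyDirectable {V : Type u} (L : SimpleGraph V) : Prop :=
  ∃ G : SimpleGraph V, IsBoundedExtension G L ∧ HasBoundedGeodesicSlices G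

end GeodesicSlices

/-! ### Levels of integers and travel times along a street of given level. -/

namespace GeodesicSlices

/-! A bounded extension `L` of the lattice is comparable with the ℓ¹ metric. It therefore suffices
to superimpose on `L` a network of roads so fast that shortest paths must use it, and whose own
metric has bounded slices.

The network is a lattice whose rows and columns are streets of different quality. The street at
coordinate `x` has level `v₂(3x+1)`; since `3x+1` never vanishes, the divisibility description of
levels has no exceptional integer, and the integers of level at least `k` form one residue class
modulo `2^k`. On a street of level `k` a unit step takes time 1, plus 1 for each of its ends that
lies on a crossing street of level at least `k`. The average pace is thus `1 + 2/2^k`, so better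
streets are faster, but a long distance is needed before the gain pays for a detour.

The key fact is `Geo.street`: a geodesic moves along a row of level `k` only within time `O(2^k)` of
one of its ends, unless that row is the best it visits. It combines `Geo.no_dip` (no horizontal step
on a row between visits of better rows) with `Geo.abs_fst_sub_le` (a better row is reached soon or
never). Consequently only boundedly many rows and columns are in use at time `t`: those of small
level are excluded, those of large level are sparse (`encard_near_le`), and the best rows of all
geodesics with given ends are few (`encard_bestRows_le`). On a fixed row, the points at time `t`
where geodesics move along it are counted through the columns by which they entered it
(`encard_rowExits_le`). This gives `StreetMetric.encard_interval_le`.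

The weights lie in `{1,2,3}`, so `roadGraph` realizes the metric without weights. Scaled by `18M`,
roads are at least twice as fast as `L`. A shortest path in the union then joins at most one road
geodesic to short pieces of `L` at the two ends, and `Comparable.interval_subset` counts its slices.
-/

/-- The level of an integer: the exponent of two in `3 x + 1`. -/
def lev (x : ℤ) : ℕ := padicValInt 2 (3 * x + 1)

lemma le_lev_iff {k : ℕ} {x : ℤ} : k ≤ lev x ↔ (2 : ℤ) ^ k ∣ 3 * x + 1 := by
  have h := padicValInt_dvd_iff (p := 2) k (3 * x + 1)
  have h0 : 3 * x + 1 ≠ 0 := by omega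
  simp only [h0, false_or, Nat.cast_ofNat] at h
  exact h.symm

lemma dvd_of_dvd_three_mul {k : ℕ} {a : ℤ} (h : (2 : ℤ) ^ k ∣ 3 * a) : (2 : ℤ) ^ k ∣ a := by
  have : IsCoprime ((2 : ℤ) ^ k) 3 := IsCoprime.pow_left ⟨-1, 1, by norm_num⟩
  exact this.dvd_of_dvd_mul_left h

/-- Since 3 is invertible modulo `2 ^ k`, the condition on `3 x + 1` singles out one residue class.
-/
lemma le_lev_iff_dvd_sub {k : ℕ} {x z : ℤ} (hx : k ≤ lev x) :
    k ≤ lev z ↔ (2 : ℤ) ^ k ∣ z - x := by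
  rw [le_lev_iff] at hx ⊢
  constructor
  · intro h
    apply dvd_of_dvd_three_mul
    have := dvd_sub h hx
    rwa [show 3 * z + 1 - (3 * x + 1) = 3 * (z - x) by ring] at this
  · intro h
    have := dvd_add (Dvd.dvd.mul_left h 3) hx
    rwa [show 3 * (z - x) + (3 * x + 1) = 3 * z + 1 by ring] at this

/-- The quotient of `3 x + 1` by `2 ^ k` is odd, and the shift adds 3 to it. -/
lemma succ_le_lev_add {k : ℕ} {x : ℤ} (hx : lev x = k) : k + 1 ≤ lev (x + 2 ^ k) := by
  have h1 : (2 : ℤ) ^ k ∣ 3 * x + 1 := le_lev_iff.1 hx.ge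
  have h2 : ¬ (2 : ℤ) ^ (k + 1) ∣ 3 * x + 1 := fun h => by have := le_lev_iff.2 h; omega
  obtain ⟨c, hc⟩ := h1
  rw [le_lev_iff]
  have hodd : ¬ (2 : ℤ) ∣ c := by
    rintro ⟨e, rfl⟩
    exact h2 ⟨e, by rw [hc]; ring⟩
  obtain ⟨e, he⟩ : ∃ e, c = 2 * e + 1 := ⟨c / 2, by omega⟩
  exact ⟨e + 2, by rw [show 3 * (x + 2 ^ k) + 1 = (3 * x + 1) + 3 * 2 ^ k by ring, hc, he]; ring⟩

lemma lev_add_of_lt {j : ℕ} {x : ℤ} (hx : j < lev x) : lev (x + 2 ^ j) = j := by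
  have h1 := (le_lev_iff_dvd_sub (z := x + 2 ^ j) (le_of_lt hx)).2 ⟨1, by ring⟩
  by_contra hne
  have h2 : j + 1 ≤ lev (x + 2 ^ j) := by omega
  have h3 := (le_lev_iff_dvd_sub (Nat.succ_le_of_lt hx)).1 h2
  rw [add_sub_cancel_left] at h3
  have := Int.le_of_dvd (by positivity) h3
  rw [pow_succ] at this
  have hp : (0 : ℤ) < 2 ^ j := by positivity
  omega

lemma succ_le_lev_sub {k : ℕ} {x : ℤ} (hx : lev x = k) : k + 1 ≤ lev (x - 2 ^ k) := by
  rw [le_lev_iff_dvd_sub (succ_le_lev_add hx)]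
  exact ⟨-1, by ring⟩

lemma lev_sub_of_lt {j : ℕ} {x : ℤ} (hx : j < lev x) : lev (x - 2 ^ j) = j := by
  have h1 := (le_lev_iff_dvd_sub (z := x - 2 ^ j) (le_of_lt hx)).2 ⟨-1, by ring⟩
  by_contra hne
  have h2 : j + 1 ≤ lev (x - 2 ^ j) := by omega
  have h3 := (le_lev_iff_dvd_sub h2).1 (Nat.succ_le_of_lt hx)
  rw [sub_sub_cancel] at h3
  have := Int.le_of_dvd (by positivity) h3
  rw [pow_succ] at this
  have hp : (0 : ℤ) < 2 ^ j := by positivity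
  omega

lemma exists_le_lev (k : ℕ) (x : ℤ) : ∃ z, x ≤ z ∧ z < x + 2 ^ k ∧ k ≤ lev z := by
  induction k with
  | zero => exact ⟨x, le_rfl, by simp, Nat.zero_le _⟩
  | succ k ih =>
    obtain ⟨z, h1, h2, h3⟩ := ih
    have hp : (0 : ℤ) < 2 ^ k := by positivity
    rcases Nat.lt_or_ge k (lev z) with h | h
    · exact ⟨z, h1, by rw [pow_succ]; omega, h⟩
    · exact ⟨z + 2 ^ k, by omega, by rw [pow_succ]; omega,
        succ_le_lev_add (le_antisymm h h3)⟩

/-- A representative of the residue class modulo `2 ^ k` of the integers of level at least `k`. -/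
noncomputable def levRep (k : ℕ) : ℤ := (exists_le_lev k 0).choose

lemma le_lev_iff_dvd {k : ℕ} {z : ℤ} : k ≤ lev z ↔ (2 : ℤ) ^ k ∣ z - levRep k :=
  le_lev_iff_dvd_sub (exists_le_lev k 0).choose_spec.2.2

/-- The time coordinate along a street of level `k`. -/
noncomputable def clock (k : ℕ) (x : ℤ) : ℤ :=
  x + (x - 1 - levRep k) / 2 ^ k + (x - levRep k) / 2 ^ k

lemma ediv_eq_pred_ediv {a q : ℤ} (hq : 0 < q) : a / q = (a - 1) / q + if q ∣ a then 1 else 0 := by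
  split_ifs with h
  · obtain ⟨c, rfl⟩ := h
    rw [Int.mul_ediv_cancel_left _ hq.ne',
      show q * c - 1 = (q - 1) + q * (c - 1) by ring, Int.add_mul_ediv_left _ _ hq.ne',
      Int.ediv_eq_zero_of_lt (by omega) (by omega)]
    ring
  · have h1 := Int.emod_add_mul_ediv a q
    have h2 := Int.emod_nonneg a hq.ne'
    have h3 := Int.emod_lt_of_pos a hq
    have h4 : a % q ≠ 0 := fun h0 => h (Int.dvd_of_emod_eq_zero h0)
    have : (a - 1) / q = a / q := by
      rw [show a - 1 = (a % q - 1) + q * (a / q) by linarith, Int.add_mul_ediv_left _ _ hq.ne',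
        Int.ediv_eq_zero_of_lt (by omega) (by omega)]
      ring
    omega

/-- One quotient in `clock` jumps on arrival at a crossing of level at least `k`, the other on
departure from it. Splitting the delay of 2 in this way makes it symmetric under reversal. -/
lemma clock_succ (k : ℕ) (x : ℤ) : clock k (x + 1) = clock k x + 1 +
    (if k ≤ lev x then 1 else 0) + (if k ≤ lev (x + 1) then 1 else 0) := by
  have hq : (0 : ℤ) < 2 ^ k := by positivity
  have h1 := ediv_eq_pred_ediv (a := x - levRep k) hq
  have h2 := ediv_eq_pred_ediv (a := x + 1 - levRep k) hq
  rw [show x + 1 - levRep k - 1 = x - levRep k by ring] at h2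
  rw [show x - levRep k - 1 = x - 1 - levRep k by ring] at h1
  simp only [clock, le_lev_iff_dvd]
  rw [show x + 1 - 1 - levRep k = x - levRep k by ring]
  omega

lemma clock_sub_le (k : ℕ) (a b : ℤ) :
    2 ^ k * (clock k b - clock k a) ≤ (2 ^ k + 2) * (b - a) + 2 * 2 ^ k := by
  have hq : (0 : ℤ) < 2 ^ k := by positivity
  have e1 := Int.mul_ediv_self_le (x := b - 1 - levRep k) hq.ne'
  have e2 := Int.mul_ediv_self_le (x := b - levRep k) hq.ne'
  have e3 := Int.lt_mul_ediv_self_add (x := a - 1 - levRep k) hq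
  have e4 := Int.lt_mul_ediv_self_add (x := a - levRep k) hq
  simp only [clock]
  nlinarith

lemma le_clock_sub (k : ℕ) (a b : ℤ) :
    (2 ^ k + 2) * (b - a) - 2 * 2 ^ k ≤ 2 ^ k * (clock k b - clock k a) := by
  have hq : (0 : ℤ) < 2 ^ k := by positivity
  have e1 := Int.mul_ediv_self_le (x := a - 1 - levRep k) hq.ne'
  have e2 := Int.mul_ediv_self_le (x := a - levRep k) hq.ne'
  have e3 := Int.lt_mul_ediv_self_add (x := b - 1 - levRep k) hq
  have e4 := Int.lt_mul_ediv_self_add (x := b - levRep k) hq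
  simp only [clock]
  nlinarith

lemma clock_sub_anti {j k : ℕ} (hjk : j ≤ k) {a b : ℤ} (h : a ≤ b) :
    clock k b - clock k a ≤ clock j b - clock j a := by
  induction b, h using Int.leInduction with
  | base => simp
  | succ b _ ih =>
    rw [clock_succ, clock_succ]
    have h1 : k ≤ lev b → j ≤ lev b := hjk.trans
    have h2 : k ≤ lev (b + 1) → j ≤ lev (b + 1) := hjk.trans
    split_ifs <;> omega

lemma sub_le_clock_sub (k : ℕ) {a b : ℤ} (h : a ≤ b) : b - a ≤ clock k b - clock k a := by
  induction b, h using Int.leInduction with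
  | base => simp
  | succ b _ ih => rw [clock_succ]; split_ifs <;> omega

lemma clock_sub_le_three (k : ℕ) {a b : ℤ} (h : a ≤ b) :
    clock k b - clock k a ≤ 3 * (b - a) := by
  induction b, h using Int.leInduction with
  | base => simp
  | succ b _ ih => rw [clock_succ]; split_ifs <;> omega

/-- A crossing of level exactly `j` delays only the worse street. This holds even when `z` is an
endpoint, because either unit step at `z` carries part of the delay. -/
lemma clock_sub_strict {j k : ℕ} (hjk : j < k) {a b z : ℤ} (hab : a < b) (haz : a ≤ z)
    (hzb : z ≤ b) (hz : lev z = j) : clock k b - clock k a < clock j b - clock j a := by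
  rcases hzb.lt_or_eq with h | rfl
  · have h1 := clock_sub_anti hjk.le haz
    have h2 := clock_sub_anti hjk.le (show z + 1 ≤ b by omega)
    have h3 := clock_succ j z
    have h4 := clock_succ k z
    have h5 : k ≤ lev (z + 1) → j ≤ lev (z + 1) := hjk.le.trans
    rw [if_pos hz.ge] at h3
    rw [if_neg (by omega)] at h4
    split_ifs at h3 h4 <;> omega
  · have h1 := clock_sub_anti hjk.le (show a ≤ z - 1 by omega)
    have h3 := clock_succ j (z - 1)
    have h4 := clock_succ k (z - 1)
    have h5 : k ≤ lev (z - 1) → j ≤ lev (z - 1) := hjk.le.trans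
    rw [sub_add_cancel, if_pos hz.ge] at h3
    rw [sub_add_cancel, if_neg (show ¬ k ≤ lev z by omega)] at h4
    split_ifs at h3 h4 <;> omega

/-- The time needed to travel between positions `a` and `b` on a street of level `k`. -/
noncomputable def len (k : ℕ) (a b : ℤ) : ℤ := |clock k b - clock k a|

lemma len_of_le (k : ℕ) {a b : ℤ} (h : a ≤ b) : len k a b = clock k b - clock k a :=
  abs_of_nonneg (by linarith [sub_le_clock_sub k h])

lemma len_comm (k : ℕ) (a b : ℤ) : len k a b = len k b a := abs_sub_comm _ _

@[simp] lemma len_self (k : ℕ) (a : ℤ) : len k a a = 0 := by simp [len]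

lemma len_nonneg (k : ℕ) (a b : ℤ) : 0 ≤ len k a b := abs_nonneg _

lemma len_triangle (k : ℕ) (a b c : ℤ) : len k a c ≤ len k a b + len k b c := by
  have := abs_sub_le (clock k c) (clock k b) (clock k a)
  simp only [len]
  linarith

lemma len_add (k : ℕ) {a b c : ℤ} (h : a ≤ b ∧ b ≤ c ∨ c ≤ b ∧ b ≤ a) :
    len k a c = len k a b + len k b c := by
  rcases h with ⟨h1, h2⟩ | ⟨h1, h2⟩
  · rw [len_of_le k h1, len_of_le k h2, len_of_le k (h1.trans h2)]; ring
  · rw [len_comm k a c, len_comm k a b, len_comm k b c,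
      len_of_le k h1, len_of_le k h2, len_of_le k (h1.trans h2)]; ring

lemma len_anti {j k : ℕ} (hjk : j ≤ k) (a b : ℤ) : len k a b ≤ len j a b := by
  rcases le_total a b with h | h
  · rw [len_of_le k h, len_of_le j h]; exact clock_sub_anti hjk h
  · rw [len_comm k, len_comm j, len_of_le k h, len_of_le j h]; exact clock_sub_anti hjk h

lemma len_strict {j k : ℕ} (hjk : j < k) {a b z : ℤ} (hab : a ≠ b)
    (h : a ≤ z ∧ z ≤ b ∨ b ≤ z ∧ z ≤ a) (hz : lev z = j) : len k a b < len j a b := by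
  rcases h with ⟨h1, h2⟩ | ⟨h1, h2⟩
  · rw [len_of_le k (h1.trans h2), len_of_le j (h1.trans h2)]
    exact clock_sub_strict hjk (by omega) h1 h2 hz
  · rw [len_comm k, len_comm j, len_of_le k (h1.trans h2), len_of_le j (h1.trans h2)]
    exact clock_sub_strict hjk (by omega) h1 h2 hz

lemma abs_le_len (k : ℕ) (a b : ℤ) : |b - a| ≤ len k a b := by
  rcases le_total a b with h | h
  · rw [len_of_le k h, abs_of_nonneg (by omega)]; exact sub_le_clock_sub k h
  · rw [len_comm, len_of_le k h, abs_of_nonpos (by omega)]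
    linarith [sub_le_clock_sub k h]

lemma len_le_three (k : ℕ) (a b : ℤ) : len k a b ≤ 3 * |b - a| := by
  rcases le_total a b with h | h
  · rw [len_of_le k h, abs_of_nonneg (by omega)]; exact clock_sub_le_three k h
  · rw [len_comm, len_of_le k h, abs_of_nonpos (by omega)]
    linarith [clock_sub_le_three k h]

lemma len_upper (k : ℕ) (a b : ℤ) : 2 ^ k * len k a b ≤ (2 ^ k + 2) * |b - a| + 2 * 2 ^ k := by
  rcases le_total a b with h | h
  · rw [len_of_le k h, abs_of_nonneg (by omega)]; exact clock_sub_le k a b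
  · rw [len_comm, len_of_le k h, abs_of_nonpos (by omega)]
    linarith [clock_sub_le k b a]

lemma len_lower (k : ℕ) (a b : ℤ) : (2 ^ k + 2) * |b - a| - 2 * 2 ^ k ≤ 2 ^ k * len k a b := by
  rcases le_total a b with h | h
  · rw [len_of_le k h, abs_of_nonneg (by omega)]; exact le_clock_sub k a b
  · rw [len_comm, len_of_le k h, abs_of_nonpos (by omega)]
    linarith [le_clock_sub k b a]

lemma len_pos (k : ℕ) {a b : ℤ} (h : a ≠ b) : 0 < len k a b :=
  lt_of_lt_of_le (abs_pos.2 (by omega)) (abs_le_len k a b)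

/-- Two integers of level above `k` have one of level `k` in between. -/
lemma exists_lev_eq_between {k : ℕ} {a b : ℤ} (hab : a ≠ b) (ha : k < lev a) (hb : k < lev b) :
    ∃ z, (a ≤ z ∧ z ≤ b ∨ b ≤ z ∧ z ≤ a) ∧ lev z = k := by
  have h := (le_lev_iff_dvd_sub (Nat.succ_le_of_lt ha)).1 (Nat.succ_le_of_lt hb)
  have hp : (0 : ℤ) < 2 ^ k := by positivity
  rcases lt_or_gt_of_ne hab with h' | h'
  · refine ⟨a + 2 ^ k, Or.inl ⟨by omega, ?_⟩, lev_add_of_lt ha⟩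
    have := Int.le_of_dvd (by omega) h
    rw [Nat.succ_eq_add_one, pow_succ] at this
    omega
  · refine ⟨a - 2 ^ k, Or.inr ⟨?_, by omega⟩, lev_sub_of_lt ha⟩
    have := Int.le_of_dvd (by omega) ((dvd_neg).2 h)
    rw [Nat.succ_eq_add_one, pow_succ] at this
    omega

/-- Integers of equal level at least `k` have one of greater level in between. -/
lemma exists_lev_lt_between {a b : ℤ} (hab : a ≠ b) (h : lev a = lev b) :
    ∃ z, (a ≤ z ∧ z ≤ b ∨ b ≤ z ∧ z ≤ a) ∧ lev a < lev z := by
  have h0 := (le_lev_iff_dvd_sub le_rfl).1 h.le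
  have hp : (0 : ℤ) < 2 ^ lev a := by positivity
  rcases lt_or_gt_of_ne hab with h' | h'
  · refine ⟨a + 2 ^ lev a, Or.inl ⟨by omega, ?_⟩, succ_le_lev_add rfl⟩
    have := Int.le_of_dvd (by omega) h0
    omega
  · refine ⟨a - 2 ^ lev a, Or.inr ⟨?_, by omega⟩, succ_le_lev_sub rfl⟩
    have := Int.le_of_dvd (by omega) ((dvd_neg).2 h0)
    omega

end GeodesicSlices

/-! ### The street metric, its lattice geodesics, and the absence of dips. -/

namespace GeodesicSlices

/-- Unit steps of the square lattice. -/
def Step (a b : ℤ × ℤ) : Prop := (a.2 = b.2 ∧ |b.1 - a.1| = 1) ∨ (a.1 = b.1 ∧ |b.2 - a.2| = 1)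

/-- The time needed for a unit step: horizontal steps use the row, vertical ones the column. -/
noncomputable def cost (a b : ℤ × ℤ) : ℤ := len (lev a.2) a.1 b.1 + len (lev a.1) a.2 b.2

lemma Step.symm {a b : ℤ × ℤ} (h : Step a b) : Step b a := by
  rcases h with ⟨h1, h2⟩ | ⟨h1, h2⟩
  · exact Or.inl ⟨h1.symm, by rw [abs_sub_comm]; exact h2⟩
  · exact Or.inr ⟨h1.symm, by rw [abs_sub_comm]; exact h2⟩

lemma Step.cost_comm {a b : ℤ × ℤ} (h : Step a b) : cost a b = cost b a := by
  rcases h with ⟨h1, h2⟩ | ⟨h1, h2⟩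
  · simp [cost, h1, len_comm]
  · simp [cost, h1, len_comm]

lemma Step.swap {a b : ℤ × ℤ} (h : Step a b) : Step a.swap b.swap := Or.symm h

lemma cost_swap (a b : ℤ × ℤ) : cost a.swap b.swap = cost a b := by
  simp [cost, add_comm]

lemma Step.cost_pos {a b : ℤ × ℤ} (h : Step a b) : 0 < cost a b := by
  have h1 := abs_le_len (lev a.2) a.1 b.1
  have h2 := abs_le_len (lev a.1) a.2 b.2
  have h3 := abs_nonneg (b.1 - a.1)
  have h4 := abs_nonneg (b.2 - a.2)
  simp only [cost]
  rcases h with ⟨_, h⟩ | ⟨_, h⟩ <;> omega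

/-- The path metric of the square lattice whose edges are weighted by `cost`. -/
structure StreetMetric (d : ℤ × ℤ → ℤ × ℤ → ℤ) : Prop where
  self : ∀ a, d a a = 0
  symm : ∀ a b, d a b = d b a
  triangle : ∀ a b c, d a c ≤ d a b + d b c
  step : ∀ a b, Step a b → d a b ≤ cost a b
  exists_step : ∀ a b, a ≠ b → ∃ c, Step a c ∧ cost a c + d c b ≤ d a b

/-- Lattice paths of `n` steps that are geodesic for `d`. -/
structure Geo (d : ℤ × ℤ → ℤ × ℤ → ℤ) (p : ℕ → ℤ × ℤ) (n : ℕ) : Prop where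
  step : ∀ i < n, Step (p i) (p (i + 1))
  cost : ∀ i < n, d (p i) (p (i + 1)) = cost (p i) (p (i + 1))
  add : ∀ i j k, i ≤ j → j ≤ k → k ≤ n → d (p i) (p k) = d (p i) (p j) + d (p j) (p k)

lemma StreetMetric.swap {d} (hd : StreetMetric d) : StreetMetric fun a b => d a.swap b.swap where
  self _ := hd.self _
  symm _ _ := hd.symm _ _
  triangle _ _ _ := hd.triangle _ _ _
  step a b h := by rw [← cost_swap]; exact hd.step _ _ h.swap
  exists_step a b h := by
    obtain ⟨c, h1, h2⟩ := hd.exists_step a.swap b.swap (fun e => h (Prod.swap_injective e))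
    refine ⟨c.swap, by simpa using h1.swap, ?_⟩
    rw [← cost_swap, Prod.swap_swap]
    exact h2

lemma Geo.swap {d p n} (hg : Geo d p n) :
    Geo (fun a b => d a.swap b.swap) (fun i => (p i).swap) n where
  step i hi := (hg.step i hi).swap
  cost i hi := by simp only [Prod.swap_swap, cost_swap]; exact hg.cost i hi
  add i j k h1 h2 h3 := by simp only [Prod.swap_swap]; exact hg.add i j k h1 h2 h3

lemma Geo.reverse {d p n} (hd : StreetMetric d) (hg : Geo d p n) : Geo d (fun i => p (n - i)) n where
  step i hi := by
    have := hg.step (n - (i + 1)) (by omega)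
    rw [show n - (i + 1) + 1 = n - i by omega] at this
    exact this.symm
  cost i hi := by
    have h1 := hg.step (n - (i + 1)) (by omega)
    have h2 := hg.cost (n - (i + 1)) (by omega)
    rw [show n - (i + 1) + 1 = n - i by omega] at h1 h2
    rw [hd.symm, h2, h1.cost_comm]
  add i j k h1 h2 h3 := by
    have := hg.add (n - k) (n - j) (n - i) (by omega) (by omega) (by omega)
    rw [hd.symm (p (n - i)) (p (n - k)), this, add_comm, hd.symm (p (n - i)) (p (n - j)),
      hd.symm (p (n - j)) (p (n - k))]

variable {d : ℤ × ℤ → ℤ × ℤ → ℤ} {p : ℕ → ℤ × ℤ} {n : ℕ}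

lemma StreetMetric.hor (hd : StreetMetric d) (x x' y : ℤ) :
    d (x, y) (x', y) ≤ len (lev y) x x' := by
  have key : ∀ {a b : ℤ}, a ≤ b → d (a, y) (b, y) ≤ len (lev y) a b := by
    intro a b hab
    induction b, hab using Int.leInduction with
    | base => simp [hd.self]
    | succ b hb ih =>
      have h1 := hd.triangle (a, y) (b, y) (b + 1, y)
      have h2 := hd.step (b, y) (b + 1, y) (Or.inl ⟨rfl, by simp⟩)
      rw [len_add (lev y) (Or.inl ⟨hb, by omega⟩ : a ≤ b ∧ b ≤ b + 1 ∨ _)]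
      simp only [GeodesicSlices.cost, len_self, add_zero] at h2
      linarith
  rcases le_total x x' with h | h
  · exact key h
  · rw [hd.symm, len_comm]; exact key h

lemma StreetMetric.ver (hd : StreetMetric d) (x y y' : ℤ) :
    d (x, y) (x, y') ≤ len (lev x) y y' := hd.swap.hor y y' x

/-- Travel from one row to another along a column of level `k`. -/
lemma StreetMetric.via_column (hd : StreetMetric d) (a b : ℤ × ℤ) (z : ℤ) :
    d a b ≤ len (lev a.2) a.1 z + len (lev z) a.2 b.2 + len (lev b.2) z b.1 := by
  have h1 := hd.hor a.1 z a.2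
  have h2 := hd.ver z a.2 b.2
  have h3 := hd.hor z b.1 b.2
  have h4 := hd.triangle (a.1, a.2) (z, a.2) (b.1, b.2)
  have h5 := hd.triangle (z, a.2) (z, b.2) (b.1, b.2)
  simp only [Prod.mk.eta] at *
  linarith

lemma StreetMetric.le_three (hd : StreetMetric d) (a b : ℤ × ℤ) :
    d a b ≤ 3 * (|b.1 - a.1| + |b.2 - a.2|) := by
  have h := hd.via_column a b a.1
  rw [len_self] at h
  linarith [len_le_three (lev a.1) a.2 b.2, len_le_three (lev b.2) a.1 b.1]

/-- Travel times are bounded below by those on better streets. -/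
lemma Geo.lower (hd : StreetMetric d) (hg : Geo d p n) {m k i j : ℕ} (hij : i ≤ j) (hj : j ≤ n)
    (hH : ∀ l, i ≤ l → l < j → (p l).2 = (p (l + 1)).2 → lev (p l).2 ≤ k)
    (hV : ∀ l, i ≤ l → l < j → (p l).1 = (p (l + 1)).1 → lev (p l).1 ≤ m) :
    len m (p i).2 (p j).2 + len k (p i).1 (p j).1 ≤ d (p i) (p j) := by
  induction j, hij using Nat.le_induction with
  | base => simp [hd.self]
  | succ j hij ih =>
    have ih := ih (by omega) (fun l h1 h2 => hH l h1 (by omega)) (fun l h1 h2 => hV l h1 (by omega))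
    rw [hg.add i j (j + 1) hij (by omega) hj, hg.cost j (by omega), GeodesicSlices.cost]
    rcases hg.step j (by omega) with ⟨h1, -⟩ | ⟨h1, -⟩
    · have := len_anti (hH j hij (by omega) h1) (p j).1 (p (j + 1)).1
      have := len_triangle k (p i).1 (p j).1 (p (j + 1)).1
      rw [← h1, len_self]
      linarith
    · have := len_anti (hV j hij (by omega) h1) (p j).2 (p (j + 1)).2
      have := len_triangle m (p i).2 (p j).2 (p (j + 1)).2
      rw [← h1, len_self]
      linarith

lemma Geo.dist_le (hd : StreetMetric d) (hg : Geo d p n) {i j : ℕ} (hij : i ≤ j) (hj : j ≤ n) :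
    |(p j).1 - (p i).1| + |(p j).2 - (p i).2| ≤ d (p i) (p j) := by
  induction j, hij using Nat.le_induction with
  | base => simp [hd.self]
  | succ j hij ih =>
    have ih := ih (by omega)
    rw [hg.add i j (j + 1) hij (by omega) hj, hg.cost j (by omega), GeodesicSlices.cost]
    have h1 := abs_le_len (lev (p j).2) (p j).1 (p (j + 1)).1
    have h2 := abs_le_len (lev (p j).1) (p j).2 (p (j + 1)).2
    have h3 := abs_sub_le (p (j + 1)).1 (p j).1 (p i).1
    have h4 := abs_sub_le (p (j + 1)).2 (p j).2 (p i).2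
    linarith

lemma exists_eq_of_between {f : ℕ → ℤ} {a b : ℕ} (hab : a ≤ b)
    (hf : ∀ i, a ≤ i → i < b → |f (i + 1) - f i| ≤ 1) {z : ℤ}
    (hz : f a ≤ z ∧ z ≤ f b ∨ f b ≤ z ∧ z ≤ f a) : ∃ l, a ≤ l ∧ l ≤ b ∧ f l = z := by
  induction b, hab using Nat.le_induction with
  | base => exact ⟨a, le_rfl, le_rfl, by omega⟩
  | succ b hab ih =>
    by_cases h : z = f (b + 1)
    · exact ⟨b + 1, by omega, le_rfl, h.symm⟩
    · have hz' : f a ≤ z ∧ z ≤ f b ∨ f b ≤ z ∧ z ≤ f a := by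
        have := abs_le.1 (hf b hab (Nat.lt_succ_self b))
        clear ih
        omega
      obtain ⟨l, h1, h2, h3⟩ := ih (fun i h1 h2 => hf i h1 (h2.trans (Nat.lt_succ_self b))) hz'
      exact ⟨l, h1, h2.trans (Nat.le_succ b), h3⟩

lemma Geo.exists_fst_eq (hg : Geo d p n) {a b : ℕ} (hab : a ≤ b) (hb : b ≤ n) {z : ℤ}
    (hz : (p a).1 ≤ z ∧ z ≤ (p b).1 ∨ (p b).1 ≤ z ∧ z ≤ (p a).1) :
    ∃ l, a ≤ l ∧ l ≤ b ∧ (p l).1 = z := by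
  refine exists_eq_of_between (f := fun i => (p i).1) hab (fun i _ h => ?_) hz
  rcases hg.step i (by omega) with ⟨_, h⟩ | ⟨h, _⟩
  · exact h.le
  · simp [h]

lemma Geo.exists_snd_eq (hg : Geo d p n) {a b : ℕ} (hab : a ≤ b) (hb : b ≤ n) {z : ℤ}
    (hz : (p a).2 ≤ z ∧ z ≤ (p b).2 ∨ (p b).2 ≤ z ∧ z ≤ (p a).2) :
    ∃ l, a ≤ l ∧ l ≤ b ∧ (p l).2 = z := hg.swap.exists_fst_eq hab hb hz

/-- If the rows between a visit of row `y` and a visit of a better row are not better than `y`,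
then the better row is next to `y`. -/
lemma eq_add_or_sub_of_lev {f : ℕ → ℤ} {a b : ℕ} (hab : a ≤ b)
    (hf : ∀ i, a ≤ i → i < b → |f (i + 1) - f i| ≤ 1) (hb : lev (f a) + 1 ≤ lev (f b))
    (hlow : ∀ s, a ≤ s → s < b → lev (f s) ≤ lev (f a)) :
    f b = f a + 2 ^ lev (f a) ∨ f b = f a - 2 ^ lev (f a) := by
  set k := lev (f a) with hk
  have h1 := succ_le_lev_add hk.symm
  have h2 := succ_le_lev_sub hk.symm
  have hp : (0 : ℤ) < 2 ^ k := by positivity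
  have d1 := (le_lev_iff_dvd_sub h1).1 hb
  have d2 := (le_lev_iff_dvd_sub h2).1 hb
  rw [pow_succ] at d1 d2
  have hne : f b ≠ f a := fun h => by rw [h] at hb; omega
  rcases lt_or_gt_of_ne hne with h | h
  · right
    by_contra hc
    have : f b < f a - 2 ^ k := by
      by_contra hlt
      have := Int.le_of_dvd (by omega) d2
      omega
    obtain ⟨l, l1, l2, l3⟩ := exists_eq_of_between hab hf (z := f a - 2 ^ k) (by omega)
    have hlb : l ≠ b := by rintro rfl; omega
    have := hlow l l1 (by omega)
    rw [l3] at this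
    omega
  · left
    by_contra hc
    have : f a + 2 ^ k < f b := by
      by_contra hlt
      have := Int.le_of_dvd (by omega) ((dvd_neg).2 d1)
      omega
    obtain ⟨l, l1, l2, l3⟩ := exists_eq_of_between hab hf (z := f a + 2 ^ k) (by omega)
    have hlb : l ≠ b := by rintro rfl; omega
    have := hlow l l1 (by omega)
    rw [l3] at this
    omega

lemma Geo.abs_snd_le (hg : Geo d p n) {i : ℕ} (hi : i < n) : |(p (i + 1)).2 - (p i).2| ≤ 1 := by
  rcases hg.step i hi with ⟨h, _⟩ | ⟨_, h⟩
  · simp [h]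
  · exact h.le

/-- The case of a tight dip whose best column is met before the horizontal step; `Geo.no_dip`
reduces to it by shrinking and reversal. Tightness puts the two better rows at distance exactly `2 ^
k` from the row of the dip. A route using these rows and the best column then beats the lower bound
that `Geo.lower` gives for the geodesic. -/
lemma Geo.no_dip_aux (hd : StreetMetric d) (hg : Geo d p n) {i l r a : ℕ} (hil : i ≤ l)
    (hlr : l + 1 ≤ r) (hr : r ≤ n) (hrow : (p l).2 = (p (l + 1)).2)
    (hi' : lev (p l).2 + 1 ≤ lev (p i).2) (hr' : lev (p l).2 + 1 ≤ lev (p r).2)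
    (hmid : ∀ s, i < s → s < r → lev (p s).2 ≤ lev (p l).2)
    (hia : i ≤ a) (hal : a ≤ l) (hmax : ∀ s, i ≤ s → s ≤ r → lev (p s).1 ≤ lev (p a).1) :
    False := by
  set k := lev (p l).2 with hk
  set m := lev (p a).1 with hm
  have hli : i < l := lt_of_le_of_ne hil (by rintro rfl; omega)
  have hlr' : l + 1 < r := lt_of_le_of_ne hlr (by rintro rfl; rw [← hrow] at hr'; omega)
  have hH : ∀ s, i ≤ s → s < r → (p s).2 = (p (s + 1)).2 → lev (p s).2 ≤ k := by
    intro s h1 h2 h3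
    rcases h1.lt_or_eq with h | rfl
    · exact hmid s h h2
    · rw [h3]; exact hmid _ (by omega) (by omega)
  have hyr := eq_add_or_sub_of_lev (f := fun s => (p s).2) (a := l) (b := r) (by omega)
    (fun s _ _ => hg.abs_snd_le (by omega)) hr' (fun s _ _ => hmid s (by omega) (by omega))
  have hyi := eq_add_or_sub_of_lev (f := fun s => (p (n - s)).2) (a := n - l) (b := n - i)
    (by omega) (fun s _ _ => (hg.reverse hd).abs_snd_le (by omega))
    (by simpa only [show n - (n - l) = l by omega, show n - (n - i) = i by omega] using hi')
    (fun s _ _ => by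
      simpa only [show n - (n - l) = l by omega] using hmid (n - s) (by omega) (by omega))
  simp only [show n - (n - l) = l by omega, show n - (n - i) = i by omega, ← hk] at hyi hyr
  have hp : (0 : ℤ) < 2 ^ k := by positivity
  -- The best column after the horizontal step. Comparing its level with that of the best column
  -- overall decides where time is saved.
  obtain ⟨a', ha', hmax'⟩ := Finset.exists_max_image (Finset.Icc (l + 1) r) (fun s => lev (p s).1)
    ⟨l + 1, by simp; omega⟩
  simp only [Finset.mem_Icc] at ha' hmax'
  set m' := lev (p a').1 with hm'
  have hm'm : m' ≤ m := hmax a' (by omega) (by omega)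
  have a1 := hg.add i a r (by omega) (by omega) hr
  have a2 := hg.add a l r (by omega) (by omega) hr
  have a3 := hg.add l (l + 1) r (by omega) (by omega) hr
  have a4 := hg.add (l + 1) a' r (by omega) (by omega) hr
  have low : ∀ s t, i ≤ s → s ≤ t → t ≤ r →
      len m (p s).2 (p t).2 + len k (p s).1 (p t).1 ≤ d (p s) (p t) := fun s t h1 h2 h3 =>
    hg.lower hd h2 (by omega) (fun l _ _ => hH l (by omega) (by omega))
      (fun l _ _ _ => hmax l (by omega) (by omega))
  have low' : ∀ s t, l + 1 ≤ s → s ≤ t → t ≤ r →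
      len m' (p s).2 (p t).2 + len k (p s).1 (p t).1 ≤ d (p s) (p t) := fun s t h1 h2 h3 =>
    hg.lower hd h2 (by omega) (fun l _ _ => hH l (by omega) (by omega))
      (fun l _ _ _ => hmax' l ⟨by omega, by omega⟩)
  have hx : (p l).1 ≠ (p (l + 1)).1 := by
    intro h
    rcases hg.step l (by omega) with ⟨_, h'⟩ | ⟨_, h'⟩
    · rw [h] at h'; simp at h'
    · rw [hrow] at h'; simp at h'
  have hstep := low l (l + 1) (by omega) (by omega) (by omega)
  have hpos := len_pos k hx
  have b1 := low i a le_rfl hia (by omega)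
  have b2 := low a l (by omega) hal (by omega)
  -- If both better rows lie on the same side they coincide, and staying on that row saves all
  -- vertical travel.
  by_cases hsame : (p i).2 = (p r).2
  · have up := hd.hor (p i).1 (p r).1 (p i).2
    rw [show ((p r).1, (p i).2) = p r by rw [hsame], Prod.mk.eta] at up
    have c1 := low i l (by omega) (by omega) (by omega)
    have c2 := low l r (by omega) (by omega) (by omega)
    have c3 := hg.add i l r (by omega) (by omega) hr
    have c4 := len_triangle k (p i).1 (p l).1 (p r).1
    have c5 := len_anti (show k ≤ lev (p i).2 by omega) (p i).1 (p r).1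
    have c6 := len_pos m (show (p i).2 ≠ (p l).2 by omega)
    have c7 := len_nonneg m (p l).2 (p r).2
    linarith
  have hbet : (p i).2 ≤ (p l).2 ∧ (p l).2 ≤ (p r).2 ∨ (p r).2 ≤ (p l).2 ∧ (p l).2 ≤ (p i).2 := by
    omega
  -- The competing route: the better row of `p i`, then the best column, then the better row of `p
  -- r`.
  have up := hd.via_column (p i) (p r) (p a).1
  rw [← hm, len_add m hbet] at up
  have b4 := low' (l + 1) a' le_rfl ha'.1 ha'.2
  have b5 := low' a' r ha'.1 ha'.2 le_rfl
  have t1 := len_triangle m (p i).2 (p a).2 (p l).2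
  have t2 := len_triangle m' (p (l + 1)).2 (p a').2 (p r).2
  rw [← hrow] at t2 b4 hstep
  have t3 := len_triangle k (p a).1 (p l).1 (p (l + 1)).1
  have t4 := len_triangle k (p a).1 (p (l + 1)).1 (p a').1
  have e1 := len_anti (show k ≤ lev (p i).2 by omega) (p i).1 (p a).1
  have e2 := len_anti (show k + 1 ≤ lev (p r).2 by omega) (p a).1 (p r).1
  have e3 := len_anti hm'm (p l).2 (p r).2
  have e4 := len_triangle (k + 1) (p a).1 (p a').1 (p r).1
  have e5 := len_anti (Nat.le_succ k) (p a).1 (p a').1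
  have e6 := len_anti (Nat.le_succ k) (p a').1 (p r).1
  rw [len_self, zero_add] at hstep
  rcases hm'm.lt_or_eq with hlt | heq
  · have hne : (p a).1 ≠ (p a').1 := fun h => by rw [hm, hm', h] at hlt; omega
    -- If `m' < k`, a row of level `m'` between the dip and the row of `p r` delays the geodesic but
    -- not the better column. Otherwise a column of level `k` between those of `p a` and `p a'`
    -- delays row travel at level `k` but not on the row of `p r`.
    rcases lt_or_ge m' k with hk' | hk'
    · obtain ⟨z, hz1, hz2⟩ : ∃ z, ((p l).2 ≤ z ∧ z ≤ (p r).2 ∨ (p r).2 ≤ z ∧ z ≤ (p l).2) ∧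
          lev z = m' := by
        have hpow : (2 : ℤ) ^ m' < 2 ^ k := pow_lt_pow_right₀ (by norm_num) hk'
        have hp' : (0 : ℤ) < 2 ^ m' := by positivity
        rcases hyr with h | h
        · exact ⟨(p l).2 + 2 ^ m', by omega, lev_add_of_lt (by omega)⟩
        · exact ⟨(p l).2 - 2 ^ m', by omega, lev_sub_of_lt (by omega)⟩
      have := len_strict hlt (show (p l).2 ≠ (p r).2 by omega) hz1 hz2
      linarith
    · obtain ⟨z, hz1, hz2⟩ : ∃ z, ((p a).1 ≤ z ∧ z ≤ (p a').1 ∨ (p a').1 ≤ z ∧ z ≤ (p a).1) ∧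
          lev z = k := by
        rcases hk'.lt_or_eq with h | h
        · exact exists_lev_eq_between hne (by omega) h
        · exact ⟨(p a').1, by omega, h.symm⟩
      have := len_strict (Nat.lt_succ_self k) hne hz1 hz2
      rw [Nat.succ_eq_add_one] at this
      linarith
  · have hxx : (p a).1 = (p a').1 := by
      by_contra hne
      obtain ⟨z, hz1, hz2⟩ := exists_lev_lt_between hne (by omega)
      obtain ⟨s, s1, s2, s3⟩ := hg.exists_fst_eq (show a ≤ a' by omega) (by omega) hz1
      have := hmax s (by omega) (by omega)
      rw [s3] at this
      omega
    have up' := hd.ver (p a).1 (p a).2 (p a').2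
    rw [show ((p a).1, (p a').2) = p a' by rw [hxx], Prod.mk.eta, ← hm] at up'
    have c1 := hg.add a l a' (by omega) (by omega) (by omega)
    have c2 := hg.add l (l + 1) a' (by omega) (by omega) (by omega)
    have c3 := len_triangle m (p a).2 (p l).2 (p a').2
    rw [heq] at b4
    have c4 := len_nonneg k (p a).1 (p l).1
    have c5 := len_nonneg k (p (l + 1)).1 (p a').1
    linarith

/-- A geodesic has no horizontal step on a row between visits of better rows. -/
lemma Geo.no_dip (hd : StreetMetric d) (hg : Geo d p n) {i l r : ℕ} (hil : i ≤ l)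
    (hlr : l + 1 ≤ r) (hr : r ≤ n) (hrow : (p l).2 = (p (l + 1)).2)
    (hi' : lev (p l).2 + 1 ≤ lev (p i).2) (hr' : lev (p l).2 + 1 ≤ lev (p r).2) : False := by
  set k := lev (p l).2 with hk
  obtain ⟨r₀, ⟨hr1, hr2⟩, hr3⟩ : ∃ r₀, (l + 1 ≤ r₀ ∧ k + 1 ≤ lev (p r₀).2) ∧
      ∀ s, s < r₀ → ¬ (l + 1 ≤ s ∧ k + 1 ≤ lev (p s).2) :=
    ⟨_, Nat.find_spec (⟨r, hlr, hr'⟩ : ∃ s, l + 1 ≤ s ∧ k + 1 ≤ lev (p s).2),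
      fun _ => Nat.find_min _⟩
  have hr₀ : r₀ ≤ r := by
    by_contra h
    exact hr3 r (by omega) ⟨hlr, hr'⟩
  obtain ⟨i₀, hi1, hi2⟩ := Finset.exists_max_image
    ((Finset.Icc i l).filter fun s => k + 1 ≤ lev (p s).2) id ⟨i, by simp only [Finset.mem_filter, Finset.mem_Icc]; exact ⟨⟨le_rfl, hil⟩, hi'⟩⟩
  simp only [Finset.mem_filter, Finset.mem_Icc, id] at hi1 hi2
  have hmid : ∀ s, i₀ < s → s < r₀ → lev (p s).2 ≤ k := by
    intro s h1 h2
    by_contra h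
    rcases le_or_gt s l with h' | h'
    · have := hi2 s ⟨⟨by omega, h'⟩, by omega⟩
      omega
    · exact hr3 s h2 ⟨by omega, by omega⟩
  obtain ⟨a, ha1, ha2⟩ := Finset.exists_max_image (Finset.Icc i₀ r₀) (fun s => lev (p s).1)
    ⟨i₀, by simp; omega⟩
  simp only [Finset.mem_Icc] at ha1 ha2
  rcases le_or_gt a l with hal | hal
  · exact hg.no_dip_aux hd hi1.1.2 hr1 (by omega) hrow hi1.2 hr2 hmid ha1.1 hal
      fun s h1 h2 => ha2 s ⟨h1, h2⟩
  · refine (hg.reverse hd).no_dip_aux hd (i := n - r₀) (l := n - (l + 1)) (r := n - i₀)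
      (a := n - a) (by omega) (by omega) (by omega) ?_ ?_ ?_ ?_ (by omega) (by omega) ?_
    all_goals simp only [show n - (n - (l + 1) + 1) = l by omega,
      show n - (n - (l + 1)) = l + 1 by omega, show n - (n - r₀) = r₀ by omega,
      show n - (n - i₀) = i₀ by omega, show n - (n - a) = a by omega, ← hrow, ← hk]
    · exact hr2
    · exact hi1.2
    · exact fun s _ _ => hmid _ (by omega) (by omega)
    · exact fun s _ _ => ha2 _ ⟨by omega, by omega⟩

end GeodesicSlices

/-! ### Streets of low level are used only near the ends; counting best rows. -/

namespace GeodesicSlices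

variable {d : ℤ × ℤ → ℤ × ℤ → ℤ} {p : ℕ → ℤ × ℤ} {n : ℕ}

lemma exists_le_lev_between {k : ℕ} {a b : ℤ} (h : 2 ^ k ≤ |b - a|) :
    ∃ z, (a ≤ z ∧ z ≤ b ∨ b ≤ z ∧ z ≤ a) ∧ |z - a| ≤ 2 ^ k ∧ z ≠ b ∧ k ≤ lev z := by
  have hp : (0 : ℤ) < 2 ^ k := by positivity
  rcases le_total a b with hab | hab
  · rw [abs_of_nonneg (by omega)] at h
    obtain ⟨z, h1, h2, h3⟩ := exists_le_lev k a
    exact ⟨z, by omega, by rw [abs_of_nonneg (by omega)]; omega, by omega, h3⟩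
  · rw [abs_of_nonpos (by omega)] at h
    obtain ⟨z, h1, h2, h3⟩ := exists_le_lev k (a - 2 ^ k + 1)
    exact ⟨z, by omega, by rw [abs_of_nonpos (by omega)]; omega, by omega, h3⟩

/-- Any longer vertical displacement would cross a row of level above `k` before time `r`. -/
lemma Geo.abs_snd_sub_le (hg : Geo d p n) {k i r : ℕ} (hir : i ≤ r) (hr : r ≤ n)
    (hlow : ∀ s, i ≤ s → s < r → lev (p s).2 ≤ k) : |(p r).2 - (p i).2| ≤ 2 ^ (k + 1) := by
  by_contra h
  obtain ⟨z, h1, -, h3, h4⟩ := exists_le_lev_between (k := k + 1) (le_of_not_ge h)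
  obtain ⟨l, l1, l2, rfl⟩ := hg.exists_snd_eq hir hr h1
  have := hlow l l1 (lt_of_le_of_ne l2 (by rintro rfl; exact h3 rfl))
  omega

/-- Before its first visit of a row of level above `k`, a geodesic moves by `O (2 ^ k)`. -/
lemma Geo.abs_fst_sub_le (hd : StreetMetric d) (hg : Geo d p n) {k i r : ℕ} (hir : i ≤ r)
    (hr : r ≤ n) (hlow : ∀ s, i ≤ s → s < r → lev (p s).2 ≤ k) (hlev : k + 1 ≤ lev (p r).2) :
    |(p r).1 - (p i).1| ≤ 10 * 2 ^ k := by
  have hp : (0 : ℤ) < 2 ^ k := by positivity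
  by_cases h : |(p r).1 - (p i).1| ≤ 2 ^ (k + 1)
  · rw [pow_succ] at h; omega
  -- The path meets a column of level above `k` within horizontal distance `2 ^ (k + 1)`. From there
  -- it competes with that column followed by the row of `p r`.
  obtain ⟨z, h1, h2, -, h4⟩ := exists_le_lev_between (k := k + 1) (le_of_not_ge h)
  obtain ⟨a, a1, a2, rfl⟩ := hg.exists_fst_eq hir hr h1
  have hy := hg.abs_snd_sub_le a2 hr (fun s h1 h2 => hlow s (by omega) h2)
  have up := hd.via_column (p a) (p r) (p a).1
  rw [len_self] at up
  obtain ⟨m, hm⟩ : ∃ m, ∀ s, a ≤ s → s ≤ r → lev (p s).1 ≤ m := by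
    obtain ⟨s, _, hs⟩ := Finset.exists_max_image (Finset.Icc a r) (fun s => lev (p s).1)
      ⟨a, by simp [a2]⟩
    exact ⟨_, fun t h1 h2 => hs t (by simp [h1, h2])⟩
  have low := hg.lower hd (m := m) (k := k) a2 hr (fun s h1 h2 _ => hlow s (by omega) h2)
    (fun s h1 h2 _ => hm s h1 h2.le)
  have e1 := len_anti h4 (p a).2 (p r).2
  have e2 := len_anti hlev (p a).1 (p r).1
  have e3 := len_upper (k + 1) (p a).2 (p r).2
  have e4 := abs_le_len m (p a).2 (p r).2
  have e5 := len_upper (k + 1) (p a).1 (p r).1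
  have e6 := len_lower k (p a).1 (p r).1
  have e7 := abs_sub_le (p r).1 (p a).1 (p i).1
  set X := |(p r).1 - (p a).1|
  set Y := |(p r).2 - (p a).2|
  rw [pow_succ] at *
  -- The better row saves about `X / 2 ^ k` horizontally, while the column loses at most `Y / 2 ^ k
  -- + 2`. With the rounding errors this gives `X ≤ 6 * 2 ^ k + Y`, where `Y ≤ 2 * 2 ^ k`.
  have hX : X ≤ 8 * 2 ^ k := by nlinarith
  linarith

lemma Geo.dist_le_of_low (hd : StreetMetric d) (hg : Geo d p n) {k r : ℕ} (hr : r ≤ n)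
    (hlow : ∀ s, s < r → lev (p s).2 ≤ k) (hlev : k + 1 ≤ lev (p r).2) :
    d (p 0) (p r) ≤ 36 * 2 ^ k := by
  have h1 := hg.abs_fst_sub_le hd (Nat.zero_le r) hr (fun s _ h => hlow s h) hlev
  have h2 := hg.abs_snd_sub_le (Nat.zero_le r) hr (fun s _ h => hlow s h)
  have h3 := hd.le_three (p 0) (p r)
  -- The constant is `36 = 3 * (10 + 2)`.
  rw [pow_succ] at h2
  linarith

lemma StreetMetric.nonneg (hd : StreetMetric d) (a b : ℤ × ℤ) : 0 ≤ d a b := by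
  have h1 := hd.triangle a b a
  rw [hd.self, hd.symm b a] at h1
  linarith

/-- A geodesic uses a street of low level only near its ends, or if it is its best street. -/
lemma Geo.street (hd : StreetMetric d) (hg : Geo d p n) {l : ℕ} (hl : l < n)
    (hrow : (p l).2 = (p (l + 1)).2) :
    d (p 0) (p (l + 1)) ≤ 36 * 2 ^ lev (p l).2 ∨ d (p l) (p n) ≤ 36 * 2 ^ lev (p l).2 ∨
      ∀ s ≤ n, lev (p s).2 ≤ lev (p l).2 := by
  set k := lev (p l).2 with hk
  have key : ∀ {q : ℕ → ℤ × ℤ} {l : ℕ}, Geo d q n → l < n →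
      (∀ s ≤ l, lev (q s).2 ≤ k) → (∃ r ≤ n, k + 1 ≤ lev (q r).2) →
      d (q 0) (q (l + 1)) ≤ 36 * 2 ^ k := by
    intro q l hq hl hlow hex
    have hr1 := Nat.find_spec hex
    have hr2 : ∀ s < Nat.find hex, _ := fun _ => Nat.find_min hex
    set r := Nat.find hex
    have hlr : l < r := by
      by_contra h
      have := hlow r (by omega)
      omega
    have h1 := hq.dist_le_of_low hd hr1.1 (fun s hs => by
      by_contra h
      exact hr2 s hs ⟨by omega, by omega⟩) hr1.2
    have h2 := hq.add 0 (l + 1) r (by omega) (by omega) hr1.1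
    linarith [hd.nonneg (q (l + 1)) (q r)]
  -- After a better row has been visited, `Geo.no_dip` forbids another one later, so the reversed
  -- path has only low rows up to this step.
  by_cases hbefore : ∃ i ≤ l, k + 1 ≤ lev (p i).2
  · obtain ⟨i, hi, hi'⟩ := hbefore
    refine Or.inr (Or.inl ?_)
    have := key (hg.reverse hd) (l := n - (l + 1)) (by omega) (fun s hs => by
      by_contra h
      exact hg.no_dip hd hi (show l + 1 ≤ n - s by omega) (by omega) hrow hi' (by omega))
      ⟨n - i, by omega, by rwa [show n - (n - i) = i by omega]⟩
    simp only [Nat.sub_zero, show n - (n - (l + 1) + 1) = l by omega] at this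
    rwa [hd.symm]
  · push Not at hbefore
    by_cases hafter : ∃ r ≤ n, k + 1 ≤ lev (p r).2
    · exact Or.inl (key hg hl (fun s hs => by have := hbefore s hs; omega) hafter)
    · push Not at hafter
      exact Or.inr (Or.inr fun s hs => by have := hafter s hs; omega)

lemma encard_le_of_injOn_int {α : Type*} {S : Set α} (f : α → ℤ) (hf : Set.InjOn f S) (a : ℤ)
    (N : ℕ) (h : ∀ x ∈ S, a ≤ f x ∧ f x < a + N) : S.encard ≤ N := by
  refine (Set.encard_le_encard_of_injOn (t := Set.Ico a (a + N)) (fun x hx => h x hx) hf).trans ?_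
  rw [← Finset.coe_Ico, Set.encard_coe_eq_coe_finsetCard, Int.card_Ico]
  simp

lemma encard_high_le (k A : ℕ) (a : ℤ) :
    {z : ℤ | |z - a| ≤ A * 2 ^ k ∧ k ≤ lev z}.encard ≤ (2 * A + 1 : ℕ) := by
  have hp : (0 : ℤ) < 2 ^ k := by positivity
  refine encard_le_of_injOn_int (fun z => (z - levRep k) / 2 ^ k) ?_
    ((a - levRep k) / 2 ^ k - A) _ ?_
  · rintro x ⟨-, hx⟩ y ⟨-, hy⟩ hxy
    have h1 := Int.mul_ediv_cancel' (le_lev_iff_dvd.1 hx)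
    have h2 := Int.mul_ediv_cancel' (le_lev_iff_dvd.1 hy)
    simp only at hxy
    rw [hxy] at h1
    linarith
  · rintro z ⟨h1, h2⟩
    have h3 := Int.mul_ediv_cancel' (le_lev_iff_dvd.1 h2)
    have h4 := Int.mul_ediv_self_le (x := a - levRep k) hp.ne'
    have h5 := Int.lt_mul_ediv_self_add (x := a - levRep k) hp
    have h6 := abs_le.1 h1
    set Z := (z - levRep k) / 2 ^ k
    set c := (a - levRep k) / 2 ^ k
    constructor
    · by_contra h
      have : Z ≤ c - A - 1 := by omega
      nlinarith
    · by_contra h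
      have : c + A + 1 ≤ Z := by push_cast at h; omega
      nlinarith

/-- For the least `k` with `t ≤ A * 2 ^ k`, all these integers have level at least `k` and lie
within `A * 2 ^ k` of `a`. -/
lemma encard_near_le (A : ℕ) (hA : 0 < A) (a t : ℤ) :
    {z : ℤ | |z - a| ≤ t ∧ t ≤ A * 2 ^ lev z}.encard ≤ (2 * A + 1 : ℕ) := by
  have hex : ∃ k : ℕ, t ≤ A * 2 ^ k := by
    obtain ⟨k, hk⟩ := pow_unbounded_of_one_lt t (show (1 : ℤ) < 2 by norm_num)
    have hA' : (1 : ℤ) ≤ A := by exact_mod_cast hA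
    have hp : (0 : ℤ) < 2 ^ k := by positivity
    exact ⟨k, by nlinarith⟩
  refine (Set.encard_le_encard ?_).trans (encard_high_le (Nat.find hex) A a)
  rintro z ⟨h1, h2⟩
  exact ⟨h1.trans (Nat.find_spec hex), Nat.find_min' hex h2⟩

/-- The rows that are best among the rows visited by some geodesic from `u` to `v`. -/
def bestRows (d : ℤ × ℤ → ℤ × ℤ → ℤ) (u v : ℤ × ℤ) : Set ℤ :=
  {y | ∃ p n, Geo d p n ∧ p 0 = u ∧ p n = v ∧ (∃ l ≤ n, (p l).2 = y) ∧
    ∀ s ≤ n, lev (p s).2 ≤ lev y}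

/-- Let `k` be the least level of a best row. A geodesic confined to rows of level at most `k` must
be nearly horizontal and not too long, since otherwise a detour to a better row would pay. All
geodesics have the same length, so all best rows lie within `42 * 2 ^ k` of `u`, and they have level
at least `k`. -/
lemma encard_bestRows_le (hd : StreetMetric d) (u v : ℤ × ℤ) :
    (bestRows d u v).encard ≤ (85 : ℕ) := by
  classical
  rcases (bestRows d u v).eq_empty_or_nonempty with h | h
  · simp [h]
  have hex : ∃ k, ∃ y ∈ bestRows d u v, lev y = k := by
    obtain ⟨y, hy⟩ := h
    exact ⟨_, y, hy, rfl⟩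
  obtain ⟨y, hy, hyk⟩ := Nat.find_spec hex
  have hmin : ∀ z ∈ bestRows d u v, Nat.find hex ≤ lev z := fun z hz =>
    Nat.find_min' hex ⟨z, hz, rfl⟩
  set k := Nat.find hex
  have hp : (1 : ℤ) ≤ 2 ^ k := one_le_pow₀ (by norm_num)
  have hD : d u v ≤ |v.1 - u.1| + 42 * 2 ^ k := by
    obtain ⟨p, n, hg, rfl, rfl, -, hlow⟩ := hy
    rw [hyk] at hlow
    obtain ⟨m, hm⟩ : ∃ m, ∀ s ≤ n, lev (p s).1 ≤ m := by
      obtain ⟨s, _, hs⟩ := Finset.exists_max_image (Finset.range (n + 1)) (fun s => lev (p s).1)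
        ⟨0, by simp⟩
      exact ⟨_, fun t h => hs t (by simp; omega)⟩
    have low := hg.lower hd (m := m) (k := k) (Nat.zero_le n) le_rfl
      (fun s _ h2 _ => hlow s h2.le) (fun s _ h2 _ => hm s h2.le)
    have hy' := hg.abs_snd_sub_le (Nat.zero_le n) le_rfl (fun s _ h2 => hlow s h2.le)
    -- The detour through row `z` costs at most `18 * 2 ^ k` vertically. Comparison with the
    -- geodesic gives `hX`, and the detour itself then gives the bound on `d u v`.
    obtain ⟨z, z1, z2, z3⟩ := exists_le_lev (k + 1) (p 0).2
    have t1 := hd.ver (p 0).1 (p 0).2 z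
    have t2 := hd.hor (p 0).1 (p n).1 z
    have t3 := hd.ver (p n).1 z (p n).2
    have t4 := hd.triangle ((p 0).1, (p 0).2) ((p 0).1, z) ((p n).1, (p n).2)
    have t5 := hd.triangle ((p 0).1, z) ((p n).1, z) ((p n).1, (p n).2)
    simp only [Prod.mk.eta] at t1 t2 t3 t4 t5
    have e1 := len_le_three (lev (p 0).1) (p 0).2 z
    have e2 := len_le_three (lev (p n).1) z (p n).2
    have e3 := len_anti z3 (p 0).1 (p n).1
    have e4 := len_upper (k + 1) (p 0).1 (p n).1
    have e5 := len_lower k (p 0).1 (p n).1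
    have e6 := len_nonneg m (p 0).2 (p n).2
    have e7 := abs_sub_le (p n).2 (p 0).2 z
    rw [abs_of_nonneg (show 0 ≤ z - (p 0).2 by omega)] at e1
    rw [abs_of_nonpos (show (p 0).2 - z ≤ 0 by omega)] at e7
    rw [pow_succ] at *
    set X := |(p n).1 - (p 0).1|
    have hX : X ≤ 18 * (2 ^ k * 2 ^ k) + 4 * 2 ^ k := by nlinarith
    have hL : len (k + 1) (p 0).1 (p n).1 ≤ X + 18 * 2 ^ k + 6 := by
      by_contra hc
      have : X + 18 * 2 ^ k + 7 ≤ len (k + 1) (p 0).1 (p n).1 := by omega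
      nlinarith
    linarith
  refine (Set.encard_le_encard ?_).trans (encard_high_le k 42 u.2)
  intro z hz
  refine ⟨?_, hmin z hz⟩
  obtain ⟨p, n, hg, rfl, rfl, ⟨l, hl, rfl⟩, -⟩ := hz
  have h1 := hg.dist_le hd (Nat.zero_le l) hl
  have h2 := hg.dist_le hd hl le_rfl
  have h3 := hg.add 0 l n (by omega) hl le_rfl
  have h4 := abs_sub_le (p n).1 (p l).1 (p 0).1
  have h5 := abs_nonneg ((p n).2 - (p l).2)
  push_cast
  linarith

end GeodesicSlices

/-! ### Bounded slices of the street metric. -/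

namespace GeodesicSlices

variable {d : ℤ × ℤ → ℤ × ℤ → ℤ} {p : ℕ → ℤ × ℤ} {n : ℕ}

lemma encard_biUnion_le_mul {α β : Type*} {R : Set α} {T : α → Set β} {a b : ℕ}
    (hR : R.encard ≤ a) (hT : ∀ y ∈ R, (T y).encard ≤ b) :
    (⋃ y ∈ R, T y).encard ≤ (a * b : ℕ) := by
  classical
  have hfin : R.Finite := Set.finite_of_encard_le_coe hR
  lift R to Finset α using hfin
  rw [Set.encard_coe_eq_coe_finsetCard] at hR
  have hRa : R.card ≤ a := by exact_mod_cast hR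
  have key : ∀ F : Finset α, F ⊆ R →
      (⋃ y ∈ (F : Set α), T y).encard ≤ (F.card * b : ℕ) := by
    intro F
    induction F using Finset.induction_on with
    | empty => simp
    | insert x F hx ih =>
      intro hF
      rw [Finset.coe_insert, Set.biUnion_insert, Finset.card_insert_of_notMem hx]
      refine (Set.encard_union_le _ _).trans ?_
      refine (add_le_add (hT x (hF (Finset.mem_insert_self x F)))
        (ih fun y hy => hF (Finset.mem_insert_of_mem hy))).trans ?_
      rw [← Nat.cast_add]
      exact_mod_cast (by ring_nf; exact le_rfl)
  refine (key R subset_rfl).trans ?_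
  exact_mod_cast Nat.mul_le_mul_right b hRa

lemma Geo.dist_pos (hd : StreetMetric d) (hg : Geo d p n) {i j : ℕ} (hij : i < j) (hj : j ≤ n) :
    0 < d (p i) (p j) := by
  rw [hg.add i (i + 1) j (by omega) hij hj, hg.cost i (by omega)]
  have := (hg.step i (by omega)).cost_pos
  linarith [hd.nonneg (p (i + 1)) (p j)]

/-- A geodesic does not reverse its direction within a row. -/
lemma Geo.eq_of_run (hd : StreetMetric d) (hg : Geo d p n) {l e : ℕ} {σ : ℤ}
    (hl : l < n) (hσ : σ = 1 ∨ σ = -1) (hnext : p (l + 1) = ((p l).1 + σ, (p l).2))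
    (he : ∀ s, e ≤ s → s ≤ l → (p s).2 = (p l).2) (j : ℕ) (hj : j + e ≤ l) :
    p (l - j) = ((p l).1 - σ * j, (p l).2) := by
  induction j using Nat.strong_induction_on with
  | _ j ih =>
  cases j with
  | zero => simp
  | succ j =>
    have ihs := fun i hi => ih i hi
    have ih := ih j (Nat.lt_succ_self j) (by omega)
    have hrow := he (l - (j + 1)) (by omega) (by omega)
    have hst := hg.step (l - (j + 1)) (by omega)
    rw [show l - (j + 1) + 1 = l - j by omega, ih] at hst
    have hnext' : p (l - j + 1) = ((p l).1 - σ * j + σ, (p l).2) := by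
      cases j with
      | zero => simpa using hnext
      | succ j =>
        have := ihs j (by omega) (by omega)
        rw [show l - (j + 1) + 1 = l - j by omega, this]
        push_cast
        ring_nf
    have hne : p (l - (j + 1)) ≠ p (l - j + 1) := by
      intro h
      have := hg.dist_pos hd (show l - (j + 1) < l - j + 1 by omega) (by omega)
      rw [h, hd.self] at this
      exact lt_irrefl _ this
    have h1 : |(p l).1 - σ * j - (p (l - (j + 1))).1| = 1 := by
      rcases hst with ⟨_, h⟩ | ⟨_, h⟩
      · exact h
      · rw [hrow] at h; simp at h
    have h2 : (p (l - (j + 1))).1 ≠ (p l).1 - σ * j + σ := by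
      intro h
      exact hne (by rw [hnext']; exact Prod.ext h hrow)
    refine Prod.ext ?_ hrow
    push_cast
    rw [mul_add, mul_one]
    generalize σ * (j : ℤ) = c at *
    rcases hσ with rfl | rfl <;> rcases abs_eq (by norm_num : (0 : ℤ) ≤ 1) |>.1 h1 with h | h <;>
      omega

/-- The positions at which geodesics from `u` to `v` leave along row `y` in direction `σ` at
time `t`. -/
def rowExits (d : ℤ × ℤ → ℤ × ℤ → ℤ) (u v : ℤ × ℤ) (t y σ : ℤ) : Set ℤ :=
  {x | ∃ p n l, Geo d p n ∧ p 0 = u ∧ p n = v ∧ l < n ∧ p l = (x, y) ∧ p (l + 1) = (x + σ, y) ∧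
    d u (x, y) = t}

/-- The columns that geodesics from `u` to `v` can use around time `t`. -/
def usedColumns (d : ℤ × ℤ → ℤ × ℤ → ℤ) (u v : ℤ × ℤ) (t : ℤ) : Set ℤ :=
  insert u.1 (bestRows (fun a b => d a.swap b.swap) u.swap v.swap ∪
    {z : ℤ | |z - u.1| ≤ t ∧ t ≤ (72 : ℕ) * 2 ^ lev z})

lemma encard_usedColumns_le (hd : StreetMetric d) (u v : ℤ × ℤ) (t : ℤ) :
    (usedColumns d u v t).encard ≤ (231 : ℕ) := by
  refine (Set.encard_insert_le _ _).trans ?_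
  refine (add_le_add_left ((Set.encard_union_le _ _).trans (add_le_add
    (encard_bestRows_le hd.swap _ _) (encard_near_le 72 (by norm_num) u.1 t))) 1).trans ?_
  norm_num

/-- Here `j` is the length of the straight run by which a geodesic through the exit arrives along
its row. Points inside the run are reached strictly before time `t`, so they are not exits. The run
starts at `u`, or where a column is left, unless it is long compared with `t`. -/
lemma exists_run (hd : StreetMetric d) {u v : ℤ × ℤ} {t y σ x : ℤ} (hσ : σ = 1 ∨ σ = -1)
    (ht : 2 * t ≤ d u v) (hx : x ∈ rowExits d u v t y σ) :
    ∃ j : ℕ, (∀ i : ℕ, 0 < i → i ≤ j → x - σ * i ∉ rowExits d u v t y σ) ∧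
      (x - σ * j ∈ usedColumns d u v t ∨ t < 6 * j) := by
  classical
  obtain ⟨p, n, l, hg, rfl, rfl, hl, hpl, hpl', hdt⟩ := hx
  have hex : ∃ e ≤ l, ∀ s, e ≤ s → s ≤ l → (p s).2 = (p l).2 :=
    ⟨l, le_rfl, fun s h1 h2 => by rw [le_antisymm h2 h1]⟩
  obtain ⟨hel, he⟩ := Nat.find_spec hex
  have hmin : ∀ e' < Nat.find hex, _ := fun _ => Nat.find_min hex
  set e := Nat.find hex
  have run := hg.eq_of_run hd hl hσ (by rw [hpl', hpl]) he
  rw [hpl] at run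
  have hadd := hg.add 0 e l (by omega) hel (by omega)
  have hD := hg.add 0 l n (by omega) hl.le le_rfl
  rw [hpl, hdt] at hadd
  rw [hpl, hdt] at hD
  refine ⟨l - e, ?_, ?_⟩
  · rintro i hi1 hi2 ⟨-, -, -, -, -, -, -, -, -, hdt'⟩
    have h1 := run i (by omega)
    simp only at h1
    rw [← h1] at hdt'
    have h2 := hg.add 0 (l - i) l (by omega) (by omega) (by omega)
    have h3 := hg.dist_pos hd (show l - i < l by omega) hl.le
    rw [hpl] at h2 h3
    linarith
  · have hpe := run (l - e) (by omega)
    rw [show l - (l - e) = e by omega] at hpe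
    simp only at hpe
    -- A run begun before time `t / 2` lasts longer than `t / 2`, and each step costs at most 3,
    -- hence the factor 6. A later start leaves at least `t / 2` before the entry and, as `2 * t ≤ d
    -- u v`, at least `t` after the exit. `Geo.street` for the column then yields the factor `72 = 2
    -- * 36`.
    by_cases htime : 2 * d (p 0) (p e) < t
    · right
      have h1 := hd.le_three (p e) (x, y)
      rw [hpe] at h1 hadd htime
      simp only [sub_self, abs_zero, add_zero] at h1
      have h2 : |x - (x - σ * ((l - e : ℕ) : ℤ))| = ((l - e : ℕ) : ℤ) := by
        rw [sub_sub_cancel, abs_mul, Nat.abs_cast]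
        rcases hσ with rfl | rfl <;> simp
      rw [h2] at h1
      linarith
    · left
      have hxe : x - σ * ((l - e : ℕ) : ℤ) = (p e).1 := by rw [hpe]
      rw [hxe]
      rcases Nat.eq_zero_or_pos e with h0 | h0
      · rw [h0]; exact Set.mem_insert _ _
      refine Set.mem_insert_of_mem _ ?_
      have hcol : (p (e - 1)).1 = (p e).1 := by
        have hst := hg.step (e - 1) (by omega)
        rw [Nat.sub_add_cancel h0] at hst
        rcases hst with ⟨h, _⟩ | ⟨h, _⟩
        · exfalso
          refine hmin (e - 1) (by omega) ⟨by omega, fun s h1 h2 => ?_⟩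
          rcases h1.lt_or_eq with h' | rfl
          · exact he s (by omega) h2
          · rw [h]; exact he e le_rfl hel
        · exact h
      have hsub : |(p e).1 - (p 0).1| ≤ t := by
        have := hg.dist_le hd (Nat.zero_le e) (by omega)
        linarith [abs_nonneg ((p e).2 - (p 0).2), hd.nonneg (p e) (x, y)]
      have hp : (0 : ℤ) < 2 ^ lev (p e).1 := by positivity
      rcases hg.swap.street hd.swap (l := e - 1) (by omega)
        (by simpa [Nat.sub_add_cancel h0] using hcol) with h | h | h
      all_goals
        simp only [Prod.swap_swap, Nat.sub_add_cancel h0, Prod.snd_swap, hcol] at h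
      · exact Or.inr ⟨hsub, by push_cast; linarith⟩
      · refine Or.inr ⟨hsub, ?_⟩
        have h2 := hg.add (e - 1) l n (by omega) (by omega) le_rfl
        rw [hpl] at h2
        push_cast
        linarith [hd.nonneg (p (e - 1)) (x, y)]
      · exact Or.inl ⟨_, n, hg.swap, rfl, rfl, ⟨e, by omega, rfl⟩, h⟩

/-- The run of one exit contains no other exit. So exits with runs from a used column are determined
by the start of the run (at most 231), and exits with long runs are far apart (at most 13). -/
lemma encard_rowExits_le (hd : StreetMetric d) (u v : ℤ × ℤ) {t y σ : ℤ} (hσ : σ = 1 ∨ σ = -1)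
    (ht : 2 * t ≤ d u v) : (rowExits d u v t y σ).encard ≤ (244 : ℕ) := by
  classical
  set Q := rowExits d u v t y σ with hQ
  have hrun : ∀ x : ℤ, ∃ j : ℕ, x ∈ Q → (∀ i : ℕ, 0 < i → i ≤ j → x - σ * i ∉ Q) ∧
      (x - σ * j ∈ usedColumns d u v t ∨ t < 6 * j) := by
    intro x
    by_cases hx : x ∈ Q
    · obtain ⟨j, hj⟩ := exists_run hd hσ ht hx
      exact ⟨j, fun _ => hj⟩
    · exact ⟨0, fun h => (hx h).elim⟩
  choose j hj using hrun
  have hsplit : Q ⊆ {x ∈ Q | x - σ * j x ∈ usedColumns d u v t} ∪ {x ∈ Q | t < 6 * j x} :=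
    fun x hx => (hj x hx).2.imp (fun h => ⟨hx, h⟩) (fun h => ⟨hx, h⟩)
  have hdiff : ∀ x ∈ Q, ∀ x' ∈ Q, ∀ i : ℤ, 0 < i → x' = x - σ * i → (j x : ℤ) < i := by
    intro x hx x' hx' i hi hxx
    by_contra hle
    refine (hj x hx).1 i.toNat (by omega) (by omega) ?_
    rw [Int.toNat_of_nonneg hi.le, ← hxx]
    exact hx'
  have hA : {x ∈ Q | x - σ * j x ∈ usedColumns d u v t}.encard ≤ (231 : ℕ) := by
    refine (Set.encard_le_encard_of_injOn (f := fun x => x - σ * j x) (fun x hx => hx.2) ?_).trans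
      (encard_usedColumns_le hd u v t)
    rintro x ⟨hx, -⟩ x' ⟨hx', -⟩ hxx
    simp only at hxx
    rcases lt_trichotomy (j x) (j x') with h | h | h
    · have := hdiff x' hx' x hx (j x' - j x) (by omega) (by rw [mul_sub]; linarith)
      omega
    · rw [h] at hxx; linarith
    · have := hdiff x hx x' hx' (j x - j x') (by omega) (by rw [mul_sub]; linarith)
      omega
  have hB : {x ∈ Q | t < 6 * j x}.encard ≤ (13 : ℕ) := by
    by_cases ht0 : 0 ≤ t
    swap
    · have : {x ∈ Q | t < 6 * j x} = ∅ := by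
        ext x
        simp only [Set.mem_ofPred_eq, Set.mem_empty_iff_false, iff_false, not_and]
        rintro ⟨p, n, l, -, -, -, -, -, -, h⟩
        have := hd.nonneg u (x, y)
        omega
      simp [this]
    -- Long runs have length at least `s`, so each block of `s` consecutive integers contains at
    -- most one such exit. Exits lie within `t < 6 * s` of `u.1`, which meets at most 13 blocks.
    set s := t / 6 + 1 with hs
    have hs0 : 0 < s := by omega
    have hlt : t < 6 * s := by omega
    refine encard_le_of_injOn_int (fun x => x / s) ?_ (u.1 / s - 6) _ ?_
    · rintro x ⟨hx, hjx⟩ x' ⟨hx', hjx'⟩ hxx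
      simp only at hxx
      have h1 := Int.mul_ediv_self_le (x := x) hs0.ne'
      have h2 := Int.lt_mul_ediv_self_add (x := x) hs0
      have h3 := Int.mul_ediv_self_le (x := x') hs0.ne'
      have h4 := Int.lt_mul_ediv_self_add (x := x') hs0
      rw [hxx] at h1 h2
      by_contra hne
      rcases hσ with rfl | rfl
      · rcases lt_or_gt_of_ne hne with h | h
        · have := hdiff x' hx' x hx (x' - x) (by omega) (by ring)
          omega
        · have := hdiff x hx x' hx' (x - x') (by omega) (by ring)
          omega
      · rcases lt_or_gt_of_ne hne with h | h
        · have := hdiff x hx x' hx' (x' - x) (by omega) (by ring)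
          omega
        · have := hdiff x' hx' x hx (x - x') (by omega) (by ring)
          omega
    · rintro x ⟨⟨p, n, l, hg, rfl, rfl, hl, hpl, -, hdt⟩, -⟩
      have h1 := hg.dist_le hd (Nat.zero_le l) hl.le
      rw [hpl, hdt] at h1
      simp only at h1
      have h2 := abs_nonneg (y - (p 0).2)
      have h3 := abs_le.1 (show |x - (p 0).1| ≤ t by linarith)
      constructor
      · rw [← Int.sub_mul_ediv_right _ _ hs0.ne']
        exact Int.ediv_le_ediv hs0 (by linarith)
      · have : x / s ≤ (p 0).1 / s + 6 := by
          rw [← Int.add_mul_ediv_right _ _ hs0.ne']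
          exact Int.ediv_le_ediv hs0 (by linarith)
        push_cast
        omega
  refine (Set.encard_le_encard hsplit).trans ((Set.encard_union_le _ _).trans
    ((add_le_add hA hB).trans ?_))
  norm_num

/-- The points of geodesics from `u` to `v` at time `t`. -/
def slice (d : ℤ × ℤ → ℤ × ℤ → ℤ) (u v : ℤ × ℤ) (t : ℤ) : Set (ℤ × ℤ) :=
  {q | ∃ p n l, Geo d p n ∧ p 0 = u ∧ p n = v ∧ l ≤ n ∧ p l = q ∧ d u q = t}

/-- The points at which geodesics from `u` to `v` make a horizontal step at time `t`. -/
def horSlice (d : ℤ × ℤ → ℤ × ℤ → ℤ) (u v : ℤ × ℤ) (t : ℤ) : Set (ℤ × ℤ) :=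
  {q | ∃ p n l, Geo d p n ∧ p 0 = u ∧ p n = v ∧ l < n ∧ p l = q ∧ (p (l + 1)).2 = q.2 ∧
    d u q = t}

/-- By `Geo.street` there are at most `158 = 85 + 73` rows, each with 244 exits in either direction.
In the first half of the journey the remaining time is at least `t`, so nearness to either end
bounds `t` by the level. -/
lemma encard_horSlice_le (hd : StreetMetric d) (u v : ℤ × ℤ) {t : ℤ} (ht : 2 * t ≤ d u v) :
    (horSlice d u v t).encard ≤ (158 * 488 : ℕ) := by
  set R := bestRows d u v ∪ {z : ℤ | |z - u.2| ≤ t ∧ t ≤ (36 : ℕ) * 2 ^ lev z} with hR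
  have hRc : R.encard ≤ (158 : ℕ) := by
    refine (Set.encard_union_le _ _).trans ((add_le_add (encard_bestRows_le hd u v)
      (encard_near_le 36 (by norm_num) u.2 t)).trans ?_)
    norm_num
  have hsub : horSlice d u v t ⊆ ⋃ y ∈ R,
      ((fun x => (x, y)) '' rowExits d u v t y 1 ∪ (fun x => (x, y)) '' rowExits d u v t y (-1)) := by
    rintro ⟨x, y⟩ ⟨p, n, l, hg, rfl, rfl, hl, hpl, hrow, hdt⟩
    simp only [Set.mem_iUnion]
    have hD := hg.add 0 l n (by omega) hl.le le_rfl
    have hl' := hg.add 0 l (l + 1) (by omega) (by omega) hl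
    have hnn := hd.nonneg (p l) (p (l + 1))
    refine ⟨y, ?_, ?_⟩
    · have hsub : |y - (p 0).2| ≤ t := by
        have := hg.dist_le hd (Nat.zero_le l) hl.le
        rw [hpl, hdt] at this
        linarith [abs_nonneg (x - (p 0).1)]
      rcases hg.street hd hl (by rw [hpl]; exact hrow.symm) with h | h | h
      all_goals simp only [hpl] at h hD hl' hnn
      · exact Or.inr ⟨hsub, by push_cast; linarith⟩
      · exact Or.inr ⟨hsub, by push_cast; linarith⟩
      · exact Or.inl ⟨p, n, hg, rfl, rfl, ⟨l, hl.le, by rw [hpl]⟩, h⟩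
    · have hst := hg.step l hl
      have key : ∀ σ : ℤ, (p (l + 1)).1 = x + σ → x ∈ rowExits d (p 0) (p n) t y σ := fun σ h =>
        ⟨p, n, l, hg, rfl, rfl, hl, hpl, Prod.ext h hrow, hdt⟩
      rw [hpl] at hst
      rcases hst with ⟨_, h⟩ | ⟨_, h⟩
      · rcases abs_eq (by norm_num : (0 : ℤ) ≤ 1) |>.1 h with h | h
        · exact Or.inl ⟨x, key 1 (by simp only at h; omega), rfl⟩
        · exact Or.inr ⟨x, key (-1) (by simp only at h; omega), rfl⟩
      · simp only at hrow h
        rw [hrow] at h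
        simp at h
  refine (Set.encard_le_encard hsub).trans (encard_biUnion_le_mul hRc fun y _ => ?_)
  refine (Set.encard_union_le _ _).trans ((add_le_add ((Set.encard_image_le _ _).trans
    (encard_rowExits_le hd u v (Or.inl rfl) ht)) ((Set.encard_image_le _ _).trans
    (encard_rowExits_le hd u v (Or.inr rfl) ht))).trans ?_)
  norm_num

lemma encard_slice_le_of_le (hd : StreetMetric d) (u v : ℤ × ℤ) {t : ℤ} (ht : 2 * t ≤ d u v) :
    (slice d u v t).encard ≤ (2 * (158 * 488) + 1 : ℕ) := by
  have hsub : slice d u v t ⊆ insert v (horSlice d u v t ∪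
      Prod.swap '' horSlice (fun a b => d a.swap b.swap) u.swap v.swap t) := by
    rintro q ⟨p, n, l, hg, rfl, rfl, hl, rfl, hdt⟩
    rcases hl.lt_or_eq with h | rfl
    · refine Set.mem_insert_of_mem _ ?_
      rcases hg.step l h with ⟨h1, -⟩ | ⟨h1, -⟩
      · exact Or.inl ⟨p, n, l, hg, rfl, rfl, h, rfl, h1.symm, hdt⟩
      · exact Or.inr ⟨(p l).swap, ⟨_, n, l, hg.swap, rfl, rfl, h, rfl, h1.symm, by simpa using hdt⟩,
          Prod.swap_swap _⟩
    · exact Set.mem_insert _ _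
  refine (Set.encard_le_encard hsub).trans ((Set.encard_insert_le _ _).trans ?_)
  refine (add_le_add_left ((Set.encard_union_le _ _).trans (add_le_add (encard_horSlice_le hd u v ht)
    ((Set.encard_image_le _ _).trans (encard_horSlice_le hd.swap u.swap v.swap
      (by simpa using ht))))) 1).trans ?_
  norm_num

/-- The second half of the journey is the first half of the reversed one. -/
lemma encard_slice_le (hd : StreetMetric d) (u v : ℤ × ℤ) (t : ℤ) :
    (slice d u v t).encard ≤ (2 * (158 * 488) + 1 : ℕ) := by
  by_cases ht : 2 * t ≤ d u v
  · exact encard_slice_le_of_le hd u v ht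
  · refine (Set.encard_le_encard ?_).trans (encard_slice_le_of_le hd v u (t := d u v - t)
      (by rw [hd.symm v u]; omega))
    rintro q ⟨p, n, l, hg, rfl, rfl, hl, rfl, hdt⟩
    refine ⟨_, n, n - l, hg.reverse hd, by simp, by simp, by omega,
      by simp [show n - (n - l) = l by omega], ?_⟩
    have := hg.add 0 l n (by omega) hl le_rfl
    rw [hd.symm]
    linarith

open Finset in
-- Optimality of the whole path forces equality in every triangle inequality along it.
lemma Geo.of_sum_le (hd : StreetMetric d) (hstep : ∀ i < n, Step (p i) (p (i + 1)))
    (hsum : ∑ i ∈ range n, GeodesicSlices.cost (p i) (p (i + 1)) ≤ d (p 0) (p n)) :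
    Geo d p n := by
  set T : ℕ → ℤ := fun j => ∑ i ∈ range j, GeodesicSlices.cost (p i) (p (i + 1)) with hT
  have hle : ∀ i j, i ≤ j → j ≤ n → d (p i) (p j) ≤ T j - T i := by
    intro i j hij
    induction j, hij using Nat.le_induction with
    | base => intro _; simp [hd.self]
    | succ j hij ih =>
      intro hj
      have h1 := hd.triangle (p i) (p j) (p (j + 1))
      have h2 := hd.step _ _ (hstep j (by omega))
      have h3 : T (j + 1) = T j + GeodesicSlices.cost (p j) (p (j + 1)) := sum_range_succ _ _
      linarith [ih (by omega)]
  have h0 : T 0 = 0 := sum_range_zero _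
  have heq : ∀ i j, i ≤ j → j ≤ n → d (p i) (p j) = T j - T i := by
    intro i j hij hj
    have h1 := hle 0 i (by omega) (by omega)
    have h2 := hle i j hij hj
    have h3 := hle j n hj le_rfl
    have h4 := hd.triangle (p 0) (p i) (p n)
    have h5 := hd.triangle (p i) (p j) (p n)
    linarith
  refine ⟨hstep, fun i hi => ?_, fun i j k h1 h2 h3 => ?_⟩
  · rw [heq i (i + 1) (by omega) hi, sub_eq_iff_eq_add']
    exact sum_range_succ _ _
  · rw [heq i j h1 (by omega), heq j k h2 h3, heq i k (by omega) h3]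
    ring

open Finset in
lemma StreetMetric.exists_path (hd : StreetMetric d) (u v : ℤ × ℤ) :
    ∃ (p : ℕ → ℤ × ℤ) (n : ℕ), p 0 = u ∧ p n = v ∧ (∀ i < n, Step (p i) (p (i + 1))) ∧
      ∑ i ∈ range n, GeodesicSlices.cost (p i) (p (i + 1)) ≤ d u v := by
  obtain ⟨N, hN⟩ : ∃ N : ℕ, d u v = N := ⟨_, (Int.toNat_of_nonneg (hd.nonneg u v)).symm⟩
  induction N using Nat.strong_induction_on generalizing u with
  | _ N ih =>
    by_cases huv : u = v
    · exact ⟨fun _ => u, 0, rfl, huv, by simp, by simp [hd.nonneg]⟩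
    · obtain ⟨c, h1, h2⟩ := hd.exists_step u v huv
      have hpos := h1.cost_pos
      have hnn := hd.nonneg c v
      obtain ⟨p, n, rfl, rfl, h3, h4⟩ := ih (d c v).toNat (by omega) c (by omega)
      refine ⟨fun i => Nat.casesOn i u p, n + 1, rfl, rfl, ?_, ?_⟩
      · rintro (_ | i) hi
        · exact h1
        · exact h3 i (by omega)
      · rw [sum_range_succ']
        show ∑ i ∈ range n, GeodesicSlices.cost (p i) (p (i + 1)) + GeodesicSlices.cost u (p 0) ≤ _
        linarith

open Finset in
lemma StreetMetric.mem_slice (hd : StreetMetric d) {u v q : ℤ × ℤ}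
    (h : d u q + d q v ≤ d u v) : q ∈ slice d u v (d u q) := by
  obtain ⟨p, n, rfl, rfl, h1, h2⟩ := hd.exists_path u q
  obtain ⟨p', n', h0', rfl, h1', h2'⟩ := hd.exists_path (p n) v
  set P : ℕ → ℤ × ℤ := fun i => if i ≤ n then p i else p' (i - n) with hP
  have hPle : ∀ i ≤ n, P i = p i := fun i hi => if_pos hi
  have hPge : ∀ i, P (n + i) = p' i := by
    intro i
    rcases Nat.eq_zero_or_pos i with rfl | hi
    · simp [hP, h0']
    · simp [hP, Nat.not_le.2 hi]
  refine ⟨P, n + n', n, Geo.of_sum_le hd ?_ ?_, hPle 0 (by omega), hPge n', by omega,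
    hPle n le_rfl, rfl⟩
  · intro i hi
    rcases lt_or_ge i n with hin | hin
    · rw [hPle i hin.le, hPle (i + 1) hin]; exact h1 i hin
    · obtain ⟨j, rfl⟩ := Nat.exists_eq_add_of_le hin
      rw [add_assoc, hPge, hPge]; exact h1' j (by omega)
  · rw [sum_range_add, hPle 0 (by omega), hPge]
    have e1 : ∑ i ∈ range n, GeodesicSlices.cost (P i) (P (i + 1)) =
        ∑ i ∈ range n, GeodesicSlices.cost (p i) (p (i + 1)) := sum_congr rfl fun i hi => by
      rw [mem_range] at hi; rw [hPle i hi.le, hPle (i + 1) hi]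
    have e2 : ∑ i ∈ range n', GeodesicSlices.cost (P (n + i)) (P (n + i + 1)) =
        ∑ i ∈ range n', GeodesicSlices.cost (p' i) (p' (i + 1)) := sum_congr rfl fun i _ => by
      rw [add_assoc, hPge, hPge]
    rw [e1, e2]
    linarith

/-- Metric slices of the street metric have uniformly bounded size. -/
lemma StreetMetric.encard_interval_le (hd : StreetMetric d) (u v : ℤ × ℤ) (t : ℤ) :
    {q | d u q + d q v = d u v ∧ d u q = t}.encard ≤ (2 * (158 * 488) + 1 : ℕ) := by
  refine (Set.encard_le_encard ?_).trans (encard_slice_le hd u v t)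
  rintro q ⟨h1, rfl⟩
  exact hd.mem_slice h1.le

end GeodesicSlices

/-! ### An unweighted graph realizing the street metric. -/

namespace GeodesicSlices

/-- The upper or right neighbour of a lattice point. -/
def next (o : Bool) (b : ℤ × ℤ) : ℤ × ℤ := if o then (b.1 + 1, b.2) else (b.1, b.2 + 1)

/-- The vertices of the road graph: the lattice points, and two vertices on each edge. -/
inductive RoadVertex
  | base (b : ℤ × ℤ)
  | mid (o i : Bool) (b : ℤ × ℤ)

open RoadVertex

/-- The edges of the road graph: each lattice edge is replaced by a path of three edges, with
shortcuts if its cost is less than three. -/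
inductive Road : RoadVertex → RoadVertex → Prop
  | first (o b) : Road (base b) (mid o false b)
  | middle (o b) : Road (mid o false b) (mid o true b)
  | last (o b) : Road (mid o true b) (base (next o b))
  | short (o b) : cost b (next o b) ≤ 2 → Road (base b) (mid o true b)
  | direct (o b) : cost b (next o b) ≤ 1 → Road (base b) (base (next o b))

/-- The unweighted graph realizing the street metric. -/
def roadGraph : SimpleGraph RoadVertex := SimpleGraph.fromRel Road

lemma step_next (o : Bool) (b : ℤ × ℤ) : Step b (next o b) := by
  cases o
  · exact Or.inr ⟨rfl, by simp [next]⟩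
  · exact Or.inl ⟨rfl, by simp [next]⟩

lemma Step.eq_next {a b : ℤ × ℤ} (h : Step a b) : ∃ o, b = next o a ∨ a = next o b := by
  obtain ⟨x, y⟩ := a
  obtain ⟨x', y'⟩ := b
  simp only [Step] at h
  rcases h with ⟨h1, h2⟩ | ⟨h1, h2⟩
  · refine ⟨true, ?_⟩
    simp only [next, if_true, Prod.mk.injEq]
    rcases abs_eq (by norm_num : (0 : ℤ) ≤ 1) |>.1 h2 with h | h <;> omega
  · refine ⟨false, ?_⟩
    simp only [next, Bool.false_eq_true, if_false, Prod.mk.injEq]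
    rcases abs_eq (by norm_num : (0 : ℤ) ≤ 1) |>.1 h2 with h | h <;> omega

lemma Step.cost_le {a b : ℤ × ℤ} (h : Step a b) : cost a b ≤ 3 := by
  have h1 := len_le_three (lev a.2) a.1 b.1
  have h2 := len_le_three (lev a.1) a.2 b.2
  simp only [cost]
  rcases h with ⟨h3, h4⟩ | ⟨h3, h4⟩
  · rw [h3, sub_self, abs_zero] at h2
    rw [h3] at h1 ⊢
    omega
  · rw [h3, sub_self, abs_zero] at h1
    rw [h3] at h2 ⊢
    omega

lemma next_ne (o : Bool) (b : ℤ × ℤ) : next o b ≠ b := by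
  intro h
  have := (step_next o b).cost_pos
  rw [h] at this
  simp [cost] at this

lemma Road.adj {a b : RoadVertex} (h : Road a b) : roadGraph.Adj a b := by
  rw [roadGraph, SimpleGraph.fromRel_adj]
  refine ⟨?_, Or.inl h⟩
  cases h
  case direct => intro h; exact next_ne _ _ (base.inj h).symm
  all_goals simp

lemma road_adj_cases {a b : RoadVertex} (h : roadGraph.Adj a b) : Road a b ∨ Road b a :=
  ((SimpleGraph.fromRel_adj _ _ _).1 h).2

/-- The distance of the road graph, as an integer. -/
noncomputable def roadDist (a b : RoadVertex) : ℤ := roadGraph.dist a b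

lemma exists_walk_next (o : Bool) (b : ℤ × ℤ) :
    ∃ w : roadGraph.Walk (base b) (base (next o b)), (w.length : ℤ) ≤ cost b (next o b) := by
  have hpos := (step_next o b).cost_pos
  by_cases h1 : cost b (next o b) ≤ 1
  · exact ⟨.cons (Road.direct o b h1).adj .nil, by simp; omega⟩
  by_cases h2 : cost b (next o b) ≤ 2
  · exact ⟨.cons (Road.short o b h2).adj (.cons (Road.last o b).adj .nil), by simp; omega⟩
  · exact ⟨.cons (Road.first o b).adj (.cons (Road.middle o b).adj (.cons (Road.last o b).adj .nil)),
      by simp; omega⟩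

lemma reachable_base (b c : ℤ × ℤ) : roadGraph.Reachable (base b) (base c) := by
  have hx : ∀ (x y : ℤ) (n : ℕ), roadGraph.Reachable (base (x, y)) (base (x + n, y)) := by
    intro x y n
    induction n with
    | zero => simp
    | succ n ih =>
      refine ih.trans ?_
      have := (exists_walk_next true (x + n, y)).choose.reachable
      simpa [next, add_assoc] using this
  have hy : ∀ (x y : ℤ) (n : ℕ), roadGraph.Reachable (base (x, y)) (base (x, y + n)) := by
    intro x y n
    induction n with
    | zero => simp
    | succ n ih =>
      refine ih.trans ?_
      have := (exists_walk_next false (x, y + n)).choose.reachable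
      simpa [next, add_assoc] using this
  have hx' : ∀ x x' y : ℤ, roadGraph.Reachable (base (x, y)) (base (x', y)) := by
    intro x x' y
    rcases le_total x x' with h | h
    · obtain ⟨n, rfl⟩ := Int.le.dest h; exact hx x y n
    · obtain ⟨n, rfl⟩ := Int.le.dest h; exact (hx x' y n).symm
  have hy' : ∀ x y y' : ℤ, roadGraph.Reachable (base (x, y)) (base (x, y')) := by
    intro x y y'
    rcases le_total y y' with h | h
    · obtain ⟨n, rfl⟩ := Int.le.dest h; exact hy x y n
    · obtain ⟨n, rfl⟩ := Int.le.dest h; exact (hy x y' n).symm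
  exact (hx' b.1 c.1 b.2).trans (hy' c.1 b.2 c.2)

/-- The lower or left end of the lattice edge of a vertex. -/
def lowEnd : RoadVertex → ℤ × ℤ
  | base b => b
  | mid _ _ b => b

/-- The upper or right end of the lattice edge of a vertex. -/
def highEnd : RoadVertex → ℤ × ℤ
  | base b => b
  | mid o _ b => next o b

lemma exists_walk_lowEnd (a : RoadVertex) :
    ∃ w : roadGraph.Walk a (base (lowEnd a)), w.length ≤ 2 := by
  rcases a with b | ⟨o, _ | _, b⟩
  · exact ⟨.nil, Nat.zero_le _⟩
  · exact ⟨.cons (Road.first o b).adj.symm .nil, Nat.le_succ _⟩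
  · exact ⟨.cons (Road.middle o b).adj.symm (.cons (Road.first o b).adj.symm .nil), le_refl 2⟩

lemma exists_walk_highEnd (a : RoadVertex) :
    ∃ w : roadGraph.Walk a (base (highEnd a)), w.length ≤ 2 := by
  rcases a with b | ⟨o, _ | _, b⟩
  · exact ⟨.nil, Nat.zero_le _⟩
  · exact ⟨.cons (Road.middle o b).adj (.cons (Road.last o b).adj .nil), le_refl 2⟩
  · exact ⟨.cons (Road.last o b).adj .nil, Nat.le_succ _⟩

lemma roadGraph_connected : roadGraph.Connected where
  preconnected a b := ((exists_walk_lowEnd a).choose.reachable.trans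
    (reachable_base _ _)).trans (exists_walk_lowEnd b).choose.reachable.symm
  nonempty := ⟨base 0⟩

lemma roadDist_le {a b : RoadVertex} (w : roadGraph.Walk a b) : roadDist a b ≤ w.length := by
  unfold roadDist
  exact_mod_cast SimpleGraph.dist_le w

lemma roadDist_self (a : RoadVertex) : roadDist a a = 0 := by simp [roadDist]

lemma roadDist_comm (a b : RoadVertex) : roadDist a b = roadDist b a := by
  simp [roadDist, SimpleGraph.dist_comm]

lemma roadDist_triangle (a b c : RoadVertex) : roadDist a c ≤ roadDist a b + roadDist b c := by
  unfold roadDist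
  exact_mod_cast roadGraph_connected.dist_triangle

lemma roadDist_lowEnd (a : RoadVertex) : roadDist a (base (lowEnd a)) ≤ 2 := by
  obtain ⟨w, hw⟩ := exists_walk_lowEnd a
  exact (roadDist_le w).trans (by exact_mod_cast hw)

lemma roadDist_highEnd (a : RoadVertex) : roadDist a (base (highEnd a)) ≤ 2 := by
  obtain ⟨w, hw⟩ := exists_walk_highEnd a
  exact (roadDist_le w).trans (by exact_mod_cast hw)

open Classical in
/-- The distance from an interior vertex of an edge to the lower end. -/
noncomputable def toLow (o i : Bool) (b : ℤ × ℤ) : ℤ :=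
  if i = false ∨ cost b (next o b) ≤ 2 then 1 else 2

/-- The distance from an interior vertex of an edge to the upper end. -/
def toHigh (i : Bool) : ℤ := if i then 1 else 2

lemma roadDist_low_le (o i : Bool) (b : ℤ × ℤ) : roadDist (mid o i b) (base b) ≤ toLow o i b := by
  unfold toLow
  split_ifs with h
  · cases i
    · exact (roadDist_le (.cons (Road.first o b).adj.symm .nil)).trans (by simp)
    · have h' : cost b (next o b) ≤ 2 := by simpa using h
      exact (roadDist_le (.cons (Road.short o b h').adj.symm .nil)).trans (by simp)
  · exact roadDist_lowEnd (mid o i b)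

lemma roadDist_high_le (o i : Bool) (b : ℤ × ℤ) :
    roadDist (mid o i b) (base (next o b)) ≤ toHigh i := by
  cases i
  · exact roadDist_highEnd (mid o false b)
  · exact (roadDist_le (.cons (Road.last o b).adj .nil)).trans (by simp [toHigh])

/-- A walk starting inside an edge leaves it through one of its ends. -/
lemma walk_from_mid {q t : RoadVertex} (w : roadGraph.Walk q t) (o i : Bool) (b : ℤ × ℤ)
    (hq : q = mid o i b) :
    toLow o i b + roadDist (base b) t ≤ w.length ∨
      toHigh i + roadDist (base (next o b)) t ≤ w.length ∨ ∃ i', t = mid o i' b := by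
  induction w generalizing i with
  | nil => exact Or.inr (Or.inr ⟨i, hq⟩)
  | @cons _ c t hadj w ih =>
    subst hq
    simp only [SimpleGraph.Walk.length_cons, Nat.cast_add, Nat.cast_one]
    have hw := roadDist_le w
    rcases road_adj_cases hadj with h | h
    · cases h with
      | middle =>
        rcases ih true rfl with h | h | h
        · left
          simp only [toLow, toHigh] at *
          split_ifs at * <;> omega
        · right; left
          simp only [toHigh] at *
          simp at *
          omega
        · exact Or.inr (Or.inr h)
      | last =>
        right; left
        simp only [toHigh, if_true]
        omega
    · cases h with
      | first =>
        left
        simp only [toLow, true_or, if_true]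
        omega
      | middle =>
        rcases ih false rfl with h | h | h
        · left
          simp only [toLow, true_or, if_true] at *
          split_ifs <;> omega
        · right; left
          simp only [toHigh] at *
          simp at *
          omega
        · exact Or.inr (Or.inr h)
      | short _ _ hc =>
        left
        simp only [toLow, hc, or_true, if_true]
        omega

/-- This reduces distances between arbitrary road vertices to distances between lattice points; the
only exception is a pair inside one subdivided edge. -/
lemma gate (q t : RoadVertex) :
    (∃ r, (r = lowEnd q ∨ r = highEnd q) ∧
      roadDist q t = roadDist q (base r) + roadDist (base r) t) ∨
    ∃ o i i' b, q = mid o i b ∧ t = mid o i' b := by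
  rcases q with b | ⟨o, i, b⟩
  · exact Or.inl ⟨b, Or.inl rfl, by simp [roadDist_self]⟩
  · obtain ⟨w, hw⟩ := roadGraph_connected.exists_walk_length_eq_dist (mid o i b) t
    have hw' : (w.length : ℤ) = roadDist (mid o i b) t := by rw [hw, roadDist]
    rcases walk_from_mid w o i b rfl with h | h | ⟨i', h⟩
    · refine Or.inl ⟨b, Or.inl rfl, le_antisymm (roadDist_triangle _ _ _) ?_⟩
      linarith [roadDist_low_le o i b]
    · refine Or.inl ⟨next o b, Or.inr rfl, le_antisymm (roadDist_triangle _ _ _) ?_⟩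
      linarith [roadDist_high_le o i b]
    · exact Or.inr ⟨o, i, i', b, rfl, h⟩

lemma gate_base (q : RoadVertex) (c : ℤ × ℤ) : ∃ r, (r = lowEnd q ∨ r = highEnd q) ∧
    roadDist q (base c) = roadDist q (base r) + roadDist (base r) (base c) := by
  rcases gate q (base c) with h | ⟨o, i, i', b, h1, h2⟩
  · exact h
  · simp at h2

/-- For `exists_step`, a shortest walk that enters an edge cannot return to its starting end. It
leaves at the other end after at least the cost of that edge, since shortcuts exist only where the
cost permits them. -/
lemma streetMetric_roadDist : StreetMetric fun a b => roadDist (base a) (base b) where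
  self a := roadDist_self _
  symm a b := roadDist_comm _ _
  triangle a b c := roadDist_triangle _ _ _
  step a b h := by
    obtain ⟨o, rfl | rfl⟩ := h.eq_next
    · obtain ⟨w, hw⟩ := exists_walk_next o a
      exact (roadDist_le w).trans hw
    · obtain ⟨w, hw⟩ := exists_walk_next o b
      rw [roadDist_comm, h.cost_comm]
      exact (roadDist_le w).trans hw
  exists_step a b hab := by
    obtain ⟨w, hw⟩ := roadGraph_connected.exists_walk_length_eq_dist (base a) (base b)
    have hw' : (w.length : ℤ) = roadDist (base a) (base b) := by rw [hw, roadDist]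
    have hcost : ∀ o c, cost c (next o c) ≤ 3 := fun o c => (step_next o c).cost_le
    cases w with
    | nil => exact (hab rfl).elim
    | @cons _ c _ hadj w =>
      simp only [SimpleGraph.Walk.length_cons, Nat.cast_add, Nat.cast_one] at hw'
      have hwc := roadDist_le w
      rcases road_adj_cases hadj with h | h
      · cases h with
        | first o =>
          refine ⟨next o a, step_next o a, ?_⟩
          rcases walk_from_mid w o false a rfl with h | h | ⟨i', h⟩
          · simp [toLow] at h; omega
          · simp [toHigh] at h; linarith [hcost o a]
          · simp at h
        | short o _ hc =>
          refine ⟨next o a, step_next o a, ?_⟩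
          rcases walk_from_mid w o true a rfl with h | h | ⟨i', h⟩
          · simp [toLow, hc] at h; omega
          · simp [toHigh] at h; linarith
          · simp at h
        | direct o _ hc => exact ⟨next o a, step_next o a, by linarith⟩
      · cases h with
        | last o c =>
          refine ⟨c, (step_next o c).symm, ?_⟩
          rw [← (step_next o c).cost_comm]
          rcases walk_from_mid w o true c rfl with h | h | ⟨i', h⟩
          · have := hcost o c
            by_cases hc : cost c (next o c) ≤ 2
            · simp [toLow, hc] at h; linarith
            · simp [toLow, hc] at h; linarith
          · simp [toHigh] at h; omega
          · simp at h
        | direct o c hc =>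
          refine ⟨c, (step_next o c).symm, ?_⟩
          rw [← (step_next o c).cost_comm]
          linarith

lemma encard_pair_le_two {α : Type*} (x y : α) : ({x, y} : Set α).encard ≤ (2 : ℕ) := by
  refine (Set.encard_insert_le _ _).trans ?_
  rw [Set.encard_singleton]
  norm_num

lemma encard_pair_biUnion_le {α β : Type*} (x y : α) {T : α → Set β} {b : ℕ}
    (hT : ∀ z, (T z).encard ≤ b) : (⋃ z ∈ ({x, y} : Set α), T z).encard ≤ (2 * b : ℕ) :=
  encard_biUnion_le_mul (a := 2) (encard_pair_le_two x y) fun z _ => hT z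

/-- The slice is covered by street metric slices between the at most two gates of `a` and the at
most two gates of `b`. -/
lemma exists_encard_base_le : ∃ B : ℕ, ∀ (a b : RoadVertex) (k : ℤ),
    {r | roadDist a (base r) + roadDist (base r) b = roadDist a b ∧
      roadDist a (base r) = k}.encard ≤ B := by
  refine ⟨2 * (2 * (2 * (158 * 488) + 1)), fun a b k => ?_⟩
  refine (Set.encard_le_encard ?_).trans (encard_pair_biUnion_le (lowEnd a) (highEnd a)
    (T := fun z => ⋃ z' ∈ ({lowEnd b, highEnd b} : Set (ℤ × ℤ)),
      {r | roadDist (base z) (base r) + roadDist (base r) (base z') =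
        roadDist (base z) (base z') ∧ roadDist (base z) (base r) = k - roadDist a (base z)})
    fun z => encard_pair_biUnion_le _ _ fun z' =>
      streetMetric_roadDist.encard_interval_le z z' _)
  rintro r ⟨h1, h2⟩
  obtain ⟨z, hz, ha⟩ := gate_base a r
  obtain ⟨z', hz', hb⟩ := gate_base b r
  simp only [Set.mem_iUnion]
  refine ⟨z, hz, z', hz', ?_, by linarith⟩
  have t1 := roadDist_triangle a (base z) b
  have t2 := roadDist_triangle (base z) (base z') b
  have t3 := roadDist_triangle (base z) (base r) (base z')
  rw [roadDist_comm (base r) b] at h1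
  rw [roadDist_comm (base z') b] at t2
  rw [roadDist_comm (base r) (base z')] at *
  linarith

/-- The vertices on the lattice edges at a lattice point. -/
def star (r : ℤ × ℤ) : Option (Bool × Bool × Bool) → RoadVertex
  | none => base r
  | some (true, o, i) => mid o i r
  | some (false, o, i) => mid o i (if o then (r.1 - 1, r.2) else (r.1, r.2 - 1))

lemma mem_range_star (q : RoadVertex) :
    q ∈ Set.range (star (lowEnd q)) ∧ q ∈ Set.range (star (highEnd q)) := by
  rcases q with b | ⟨o, i, b⟩
  · exact ⟨⟨none, rfl⟩, ⟨none, rfl⟩⟩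
  · refine ⟨⟨some (true, o, i), rfl⟩, ⟨some (false, o, i), ?_⟩⟩
    cases o <;> simp [star, highEnd, next]

lemma encard_range_star_le (r : ℤ × ℤ) : (Set.range (star r)).encard ≤ (9 : ℕ) := by
  rw [← Set.image_univ]
  refine (Set.encard_image_le _ _).trans ?_
  rw [Set.encard_univ, ENat.card_eq_coe_fintype_card]
  simp

/-- Metric slices of the road graph have uniformly bounded size. -/
lemma exists_encard_road_le : ∃ B : ℕ, ∀ (a b : RoadVertex) (k : ℤ),
    {q | roadDist a q + roadDist q b = roadDist a b ∧ roadDist a q = k}.encard ≤ B := by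
  obtain ⟨B, hB⟩ := exists_encard_base_le
  refine ⟨3 * (B * 9) + 9, fun a b k => ?_⟩
  -- A vertex `q` of the slice has a gate towards `b` at distance `s ≤ 2`; the gate lies in the
  -- slice at `k + s`, and `q` is in its star of 9 vertices. The additional 9 accounts for `q`
  -- inside the same edge as `b`.
  set R : ℤ → Set (ℤ × ℤ) := fun s => {r | roadDist a (base r) + roadDist (base r) b =
    roadDist a b ∧ roadDist a (base r) = k + s} with hR
  have hsub : {q | roadDist a q + roadDist q b = roadDist a b ∧ roadDist a q = k} ⊆
      (⋃ s ∈ ({0, 1, 2} : Set ℤ), ⋃ r ∈ R s, Set.range (star r)) ∪ Set.range (star (lowEnd b)) := by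
    rintro q ⟨h1, h2⟩
    rcases gate q b with ⟨r, hr, hd⟩ | ⟨o, i, i', c, rfl, rfl⟩
    · left
      have hq : q ∈ Set.range (star r) := by
        rcases hr with rfl | rfl
        exacts [(mem_range_star q).1, (mem_range_star q).2]
      have hle : roadDist q (base r) ≤ 2 := by
        rcases hr with rfl | rfl
        exacts [roadDist_lowEnd q, roadDist_highEnd q]
      have hnn : 0 ≤ roadDist q (base r) := Int.natCast_nonneg _
      have t1 := roadDist_triangle a q (base r)
      have t2 := roadDist_triangle a (base r) b
      simp only [Set.mem_iUnion]
      refine ⟨roadDist q (base r), ?_, r, ⟨by linarith, by linarith⟩, hq⟩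
      simp only [Set.mem_insert_iff, Set.mem_singleton_iff]
      omega
    · exact Or.inr (mem_range_star (mid o i c)).1
  refine (Set.encard_le_encard hsub).trans ((Set.encard_union_le _ _).trans ?_)
  have h3 : ({0, 1, 2} : Set ℤ).encard ≤ (3 : ℕ) := by
    refine (Set.encard_insert_le _ _).trans ((add_le_add (encard_pair_le_two _ _) le_rfl).trans ?_)
    norm_num
  refine (add_le_add (encard_biUnion_le_mul h3 fun s _ => encard_biUnion_le_mul (hB a b (k + s))
    fun r _ => encard_range_star_le r) (encard_range_star_le _)).trans ?_
  exact_mod_cast le_rfl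

/-! ### The road graph placed in the plane. -/

/-- The `ℓ¹` distance in the plane. -/
def l1 (a b : ℤ × ℤ) : ℤ := |a.1 - b.1| + |a.2 - b.2|

lemma l1_comm (a b : ℤ × ℤ) : l1 a b = l1 b a := by
  simp [l1, abs_sub_comm]

lemma l1_triangle (a b c : ℤ × ℤ) : l1 a c ≤ l1 a b + l1 b c := by
  have h1 := abs_sub_le a.1 b.1 c.1
  have h2 := abs_sub_le a.2 b.2 c.2
  simp only [l1]
  linarith

lemma l1_nonneg (a b : ℤ × ℤ) : 0 ≤ l1 a b := add_nonneg (abs_nonneg _) (abs_nonneg _)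

lemma one_le_l1 {a b : ℤ × ℤ} (h : a ≠ b) : 1 ≤ l1 a b := by
  by_contra hc
  have h1 := abs_nonneg (a.1 - b.1)
  have h2 := abs_nonneg (a.2 - b.2)
  simp only [l1] at hc
  have h3 := abs_eq_zero.1 (show |a.1 - b.1| = 0 by omega)
  have h4 := abs_eq_zero.1 (show |a.2 - b.2| = 0 by omega)
  exact h (Prod.ext (by omega) (by omega))

/-- The positions of the vertices of the road graph in the plane. -/
def place : RoadVertex → ℤ × ℤ
  | base b => (3 * b.1, 3 * b.2)
  | mid true i b => (3 * b.1 + (if i then 2 else 1), 3 * b.2)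
  | mid false i b => (3 * b.1, 3 * b.2 + (if i then 2 else 1))

lemma place_injective : Function.Injective place := by
  rintro (⟨x, y⟩ | ⟨_ | _, _ | _, ⟨x, y⟩⟩) (⟨x', y'⟩ | ⟨_ | _, _ | _, ⟨x', y'⟩⟩) h <;>
    simp only [place, Prod.mk.injEq, if_true, if_false, Bool.false_eq_true] at h <;>
    first
    | (exfalso; omega)
    | (obtain ⟨rfl, rfl⟩ : x = x' ∧ y = y' := by omega
       rfl)

lemma l1_place_lowEnd (a : RoadVertex) : l1 (place a) (place (base (lowEnd a))) ≤ 2 := by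
  rcases a with b | ⟨_ | _, _ | _, b⟩ <;> simp [place, lowEnd, l1]

lemma l1_place_le_of_adj {a b : RoadVertex} (h : roadGraph.Adj a b) :
    l1 (place a) (place b) ≤ 3 := by
  have key : ∀ {a b}, Road a b → l1 (place a) (place b) ≤ 3 := by
    intro a b h
    cases h with
    | first o b => cases o <;> simp [place, l1]
    | middle o b => cases o <;> simp [place, l1]
    | last o b =>
      cases o <;> simp only [place, l1, next] <;> simp <;> ring_nf <;> norm_num
    | short o b => cases o <;> simp [place, l1]
    | direct o b =>
      cases o <;> simp only [place, l1, next] <;> simp <;> ring_nf <;> norm_num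
  rcases road_adj_cases h with h | h
  · exact key h
  · rw [l1_comm]; exact key h

/-- Passing to the low ends changes each of the two distances by at most 4. Between lattice points
the factor 3 of `StreetMetric.le_three` is cancelled by the spacing 3 of `place`. This gives `l1 +
8`, at most `9 * l1` for distinct points. -/
lemma roadDist_le_l1 (a b : RoadVertex) : roadDist a b ≤ 9 * l1 (place a) (place b) := by
  by_cases hab : a = b
  · rw [hab, roadDist_self]
    linarith [l1_nonneg (place b) (place b)]
  have h1 := roadDist_lowEnd a
  have h2 := roadDist_lowEnd b
  have h3 := streetMetric_roadDist.le_three (lowEnd a) (lowEnd b)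
  have h4 := roadDist_triangle a (base (lowEnd a)) b
  have h5 := roadDist_triangle (base (lowEnd a)) (base (lowEnd b)) b
  rw [roadDist_comm (base (lowEnd b)) b] at h5
  have h6 := l1_place_lowEnd a
  have h7 := l1_place_lowEnd b
  have h8 := l1_triangle (place (base (lowEnd a))) (place a) (place (base (lowEnd b)))
  have h9 := l1_triangle (place a) (place b) (place (base (lowEnd b)))
  have h12 := l1_comm (place (base (lowEnd a))) (place a)
  have h10 : l1 (place (base (lowEnd a))) (place (base (lowEnd b))) =
      3 * (|(lowEnd b).1 - (lowEnd a).1| + |(lowEnd b).2 - (lowEnd a).2|) := by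
    simp only [place, l1, ← mul_sub, abs_mul]
    rw [abs_sub_comm (lowEnd b).1, abs_sub_comm (lowEnd b).2]
    norm_num
    ring
  have h11 := one_le_l1 (place_injective.ne hab)
  linarith

lemma exists_place_near (z : ℤ × ℤ) : ∃ a, l1 z (place a) ≤ 4 := by
  refine ⟨base (z.1 / 3, z.2 / 3), ?_⟩
  simp only [l1, place]
  rw [abs_of_nonneg (by omega), abs_of_nonneg (by omega)]
  omega

end GeodesicSlices

/-! ### Adding scaled roads to a bounded extension of the lattice. -/

namespace GeodesicSlices

open RoadVertex

lemma exists_encard_ball_le (r : ℤ) : ∃ B : ℕ, ∀ u, {q | l1 u q ≤ r}.encard ≤ B := by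
  refine ⟨(2 * r + 1).toNat * (2 * r + 1).toNat, fun u => ?_⟩
  have hsub : {q | l1 u q ≤ r} ⊆
      (Finset.Icc (u.1 - r, u.2 - r) (u.1 + r, u.2 + r) : Finset (ℤ × ℤ)) := by
    intro q hq
    have hq' : |u.1 - q.1| + |u.2 - q.2| ≤ r := hq
    have h1 := abs_nonneg (u.1 - q.1)
    have h2 := abs_nonneg (u.2 - q.2)
    have h3 := abs_le.1 (show |u.1 - q.1| ≤ r by omega)
    have h4 := abs_le.1 (show |u.2 - q.2| ≤ r by omega)
    simp only [Finset.coe_Icc, Set.mem_Icc, Prod.le_def]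
    omega
  refine (Set.encard_le_encard hsub).trans ?_
  rw [Set.encard_coe_eq_coe_finsetCard, Finset.card_Icc_prod, Int.card_Icc, Int.card_Icc]
  have h1 : u.1 + r + 1 - (u.1 - r) = 2 * r + 1 := by ring
  have h2 : u.2 + r + 1 - (u.2 - r) = 2 * r + 1 := by ring
  simp only [h1, h2]
  exact le_rfl

lemma l1_le_length {u v : ℤ × ℤ} (w : squareLattice.Walk u v) : l1 u v ≤ w.length := by
  induction w with
  | nil => simp [l1]
  | @cons a b c h w ih =>
    have h1 : l1 a b = 1 := h
    have := l1_triangle a b c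
    simp only [SimpleGraph.Walk.length_cons, Nat.cast_add, Nat.cast_one]
    omega

lemma exists_toward {u v : ℤ × ℤ} (h : u ≠ v) : ∃ c, l1 u c = 1 ∧ l1 c v + 1 = l1 u v := by
  obtain ⟨x, y⟩ := u
  obtain ⟨x', y'⟩ := v
  simp only [l1]
  rcases lt_trichotomy x x' with hx | rfl | hx
  · refine ⟨(x + 1, y), by simp, ?_⟩
    rw [abs_of_nonpos (by simp; omega), abs_of_neg (a := x - x') (by omega)]
    ring
  · rcases lt_trichotomy y y' with hy | rfl | hy
    · refine ⟨(x, y + 1), by simp, ?_⟩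
      rw [abs_of_nonpos (a := y + 1 - y') (by omega), abs_of_neg (a := y - y') (by omega)]
      ring
    · exact (h rfl).elim
    · refine ⟨(x, y - 1), by simp, ?_⟩
      rw [abs_of_nonneg (a := y - 1 - y') (by omega), abs_of_pos (a := y - y') (by omega)]
      ring
  · refine ⟨(x - 1, y), by simp, ?_⟩
    rw [abs_of_nonneg (a := x - 1 - x') (by omega), abs_of_pos (a := x - x') (by omega)]
    ring

lemma exists_lattice_walk (n : ℕ) : ∀ u v : ℤ × ℤ, l1 u v ≤ n →
    ∃ w : squareLattice.Walk u v, w.length ≤ n := by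
  induction n with
  | zero =>
    intro u v h
    obtain rfl : u = v := by
      by_contra hne
      have := one_le_l1 hne
      simp at h
      omega
    exact ⟨.nil, le_rfl⟩
  | succ n ih =>
    intro u v h
    by_cases huv : u = v
    · subst huv
      exact ⟨.nil, Nat.zero_le _⟩
    · obtain ⟨c, h1, h2⟩ := exists_toward huv
      obtain ⟨w, hw⟩ := ih c v (by push_cast at h; omega)
      exact ⟨.cons (show squareLattice.Adj u c from h1) w, by simpa using hw⟩

lemma squareLattice_edist_le {u v : ℤ × ℤ} {n : ℕ} (h : l1 u v ≤ n) :
    squareLattice.edist u v ≤ n := by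
  obtain ⟨w, hw⟩ := exists_lattice_walk n u v h
  exact (SimpleGraph.edist_le w).trans (by exact_mod_cast hw)

lemma l1_le_of_edist_le {u v : ℤ × ℤ} {n : ℕ} (h : squareLattice.edist u v ≤ n) :
    l1 u v ≤ n := by
  have hne : squareLattice.edist u v ≠ ⊤ := fun ht => by simp [ht] at h
  obtain ⟨w, hw⟩ := SimpleGraph.exists_walk_of_edist_ne_top hne
  have := l1_le_length w
  rw [← hw] at h
  have h' : w.length ≤ n := by exact_mod_cast h
  omega

/-- The road graph scaled by `K`, placed in the plane. -/
def scaled (K : ℤ) (a : RoadVertex) : ℤ × ℤ := (K * (place a).1, K * (place a).2)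

lemma l1_scaled {K : ℤ} (hK : 0 ≤ K) (a b : RoadVertex) :
    l1 (scaled K a) (scaled K b) = K * l1 (place a) (place b) := by
  simp only [l1, scaled, ← mul_sub, abs_mul, abs_of_nonneg hK]
  ring

/-- Rounding to multiples of `K` contributes `2 * K`, and `exists_place_near` contributes `4 * K`.
-/
lemma exists_scaled_near {K : ℤ} (hK : 0 < K) (z : ℤ × ℤ) : ∃ a, l1 z (scaled K a) ≤ 6 * K := by
  obtain ⟨a, ha⟩ := exists_place_near (z.1 / K, z.2 / K)
  refine ⟨a, ?_⟩
  have h1 := l1_triangle z (K * (z.1 / K), K * (z.2 / K)) (scaled K a)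
  have h2 : l1 (K * (z.1 / K), K * (z.2 / K)) (scaled K a) =
      K * l1 (z.1 / K, z.2 / K) (place a) := by
    simp only [l1, scaled, ← mul_sub, abs_mul, abs_of_nonneg hK.le]
    ring
  have h3 : l1 z (K * (z.1 / K), K * (z.2 / K)) ≤ 2 * K := by
    have e1 := Int.emod_add_mul_ediv z.1 K
    have e2 := Int.emod_add_mul_ediv z.2 K
    have m1 := Int.emod_nonneg z.1 hK.ne'
    have m2 := Int.emod_nonneg z.2 hK.ne'
    have l1' := Int.emod_lt_of_pos z.1 hK
    have l2' := Int.emod_lt_of_pos z.2 hK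
    simp only [l1]
    rw [abs_of_nonneg (by linarith), abs_of_nonneg (by linarith)]
    linarith
  nlinarith

/-- A connected graph on the plane lattice, comparable with the `ℓ¹` metric. -/
structure Comparable (L : SimpleGraph (ℤ × ℤ)) (M : ℤ) : Prop where
  pos : 0 < M
  connected : L.Connected
  dist_le (u v : ℤ × ℤ) : (L.dist u v : ℤ) ≤ l1 u v
  l1_le (u v : ℤ × ℤ) : l1 u v ≤ M * L.dist u v

lemma comparable_of_edist_le {L : SimpleGraph (ℤ × ℤ)} {M : ℕ} (hle : squareLattice ≤ L)
    (hM : ∀ u v, L.Adj u v → squareLattice.edist u v ≤ M) : Comparable L (M + 1) where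
  pos := by positivity
  connected :=
    { preconnected := fun u v =>
        ((exists_lattice_walk _ u v (Int.self_le_toNat _)).choose.mapLe hle).reachable
      nonempty := ⟨0⟩ }
  dist_le u v := by
    obtain ⟨w, hw⟩ := exists_lattice_walk _ u v (Int.self_le_toNat _)
    have h1 := SimpleGraph.dist_le (w.mapLe hle)
    rw [SimpleGraph.Walk.length_map] at h1
    have := Int.toNat_of_nonneg (l1_nonneg u v)
    omega
  l1_le u v := by
    have key : ∀ {u v} (w : L.Walk u v), l1 u v ≤ (M + 1) * w.length := by
      intro u v w
      induction w with
      | nil => simp [l1]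
      | @cons a b c h w ih =>
        have h1 := l1_le_of_edist_le (hM _ _ h)
        have h2 := l1_triangle a b c
        simp only [SimpleGraph.Walk.length_cons, Nat.cast_add, Nat.cast_one]
        linarith
    have hc : L.Reachable u v :=
      ((exists_lattice_walk _ u v (Int.self_le_toNat _)).choose.mapLe hle).reachable
    obtain ⟨w, hw⟩ := hc.exists_walk_length_eq_dist
    rw [← hw]
    exact key w

/-- The graph `L` together with the road graph scaled by `K`. -/
def withRoads (L : SimpleGraph (ℤ × ℤ)) (K : ℤ) : SimpleGraph (ℤ × ℤ) where
  Adj p q := L.Adj p q ∨ p ≠ q ∧ ∃ a b, roadGraph.Adj a b ∧ scaled K a = p ∧ scaled K b = q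
  symm := ⟨by
    rintro p q (h | ⟨hne, a, b, h, h1, h2⟩)
    exacts [Or.inl h.symm, Or.inr ⟨hne.symm, b, a, h.symm, h2, h1⟩]⟩
  loopless := ⟨by
    rintro p (h | ⟨h, -⟩)
    exacts [L.loopless.irrefl _ h, h rfl]⟩

namespace Comparable

variable {L : SimpleGraph (ℤ × ℤ)} {M : ℤ}

lemma dist_triangle (hL : Comparable L M) (u v w : ℤ × ℤ) :
    (L.dist u w : ℤ) ≤ L.dist u v + L.dist v w := by
  exact_mod_cast hL.connected.dist_triangle

/-- The reason for the scale `18 * M`: the factor `M` absorbs the distortion of `L`, 9 that of the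
roads, and 2 makes roads strictly preferable. -/
lemma roadDist_le_half (hL : Comparable L M) (a b : RoadVertex) :
    2 * roadDist a b ≤ L.dist (scaled (18 * M) a) (scaled (18 * M) b) := by
  have hM := hL.pos
  have h1 := hL.l1_le (scaled (18 * M) a) (scaled (18 * M) b)
  rw [l1_scaled (by linarith)] at h1
  have h2 := roadDist_le_l1 a b
  have h3 : M * (18 * l1 (place a) (place b)) ≤
      M * L.dist (scaled (18 * M) a) (scaled (18 * M) b) := by linarith
  linarith [le_of_mul_le_mul_left h3 hM]

lemma scaled_injective (hL : Comparable L M) : Function.Injective (scaled (18 * M)) := by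
  intro a b h
  have hM := hL.pos
  simp only [scaled, Prod.mk.injEq] at h
  have hne : 18 * M ≠ 0 := by linarith
  exact place_injective (Prod.ext (mul_left_cancel₀ hne h.1) (mul_left_cancel₀ hne h.2))

lemma le_withRoads (L : SimpleGraph (ℤ × ℤ)) (K : ℤ) : L ≤ withRoads L K :=
  SimpleGraph.le_iff_adj.2 fun _ _ h => Or.inl h

lemma withRoads_connected (hL : Comparable L M) (K : ℤ) : (withRoads L K).Connected :=
  hL.connected.mono (le_withRoads L K)

lemma withRoads_triangle (hL : Comparable L M) (K : ℤ) (u v w : ℤ × ℤ) :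
    ((withRoads L K).dist u w : ℤ) ≤ (withRoads L K).dist u v + (withRoads L K).dist v w := by
  exact_mod_cast (hL.withRoads_connected K).dist_triangle

lemma withRoads_dist_le (hL : Comparable L M) (K : ℤ) (u v : ℤ × ℤ) :
    ((withRoads L K).dist u v : ℤ) ≤ L.dist u v := by
  obtain ⟨w, hw⟩ := hL.connected.exists_walk_length_eq_dist u v
  rw [← hw]
  have := SimpleGraph.dist_le (w.mapLe (le_withRoads L K))
  rw [SimpleGraph.Walk.length_map] at this
  exact_mod_cast this

lemma withRoads_dist_scaled_le (hL : Comparable L M) (a b : RoadVertex) :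
    ((withRoads L (18 * M)).dist (scaled (18 * M) a) (scaled (18 * M) b) : ℤ) ≤ roadDist a b := by
  let f : roadGraph →g withRoads L (18 * M) :=
    ⟨scaled (18 * M), fun h => Or.inr ⟨hL.scaled_injective.ne h.ne, _, _, h, rfl, rfl⟩⟩
  obtain ⟨w, hw⟩ := roadGraph_connected.exists_walk_length_eq_dist a b
  have := SimpleGraph.dist_le (w.map f)
  rw [SimpleGraph.Walk.length_map, hw] at this
  unfold roadDist
  exact_mod_cast this

lemma withRoads_dist_le_via (hL : Comparable L M) (u v : ℤ × ℤ) (a b : RoadVertex) :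
    ((withRoads L (18 * M)).dist u v : ℤ) ≤
      L.dist u (scaled (18 * M) a) + roadDist a b + L.dist (scaled (18 * M) b) v := by
  have h1 := hL.withRoads_triangle (18 * M) u (scaled (18 * M) a) v
  have h2 := hL.withRoads_triangle (18 * M) (scaled (18 * M) a) (scaled (18 * M) b) v
  have h3 := hL.withRoads_dist_le (18 * M) u (scaled (18 * M) a)
  have h4 := hL.withRoads_dist_le (18 * M) (scaled (18 * M) b) v
  have h5 := hL.withRoads_dist_scaled_le a b
  linarith

/-- A stretch of `L` between two stretches of road can be replaced by road without loss, so all road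
stretches merge into one. -/
lemma walk_withRoads (hL : Comparable L M) {u v : ℤ × ℤ} (w : (withRoads L (18 * M)).Walk u v) :
    (L.dist u v : ℤ) ≤ w.length ∨ ∃ a b,
      L.dist u (scaled (18 * M) a) + roadDist a b + L.dist (scaled (18 * M) b) v ≤ w.length := by
  induction w with
  | nil => exact Or.inl (by simp)
  | @cons x y z h w ih =>
    simp only [SimpleGraph.Walk.length_cons, Nat.cast_add, Nat.cast_one]
    rcases h with h | ⟨-, a', b', h, rfl, rfl⟩
    · have h1 : (L.dist x y : ℤ) ≤ 1 := by
        exact_mod_cast SimpleGraph.dist_le (SimpleGraph.Walk.cons h .nil)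
      rcases ih with ih | ⟨a, b, ih⟩
      · exact Or.inl (by linarith [hL.dist_triangle x y z])
      · exact Or.inr ⟨a, b, by linarith [hL.dist_triangle x y (scaled (18 * M) a)]⟩
    · have h1 : roadDist a' b' ≤ 1 := (roadDist_le (.cons h .nil)).trans (by simp)
      right
      rcases ih with ih | ⟨a, b, ih⟩
      · exact ⟨a', b', by rw [SimpleGraph.dist_self]; push_cast; linarith⟩
      · refine ⟨a', b, ?_⟩
        rw [SimpleGraph.dist_self]
        have h2 := roadDist_triangle a' b' b
        have h3 := roadDist_triangle b' a b
        have h4 := hL.roadDist_le_half b' a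
        have h5 : 0 ≤ roadDist b' a := Int.natCast_nonneg _
        push_cast
        linarith

lemma withRoads_dist_eq (hL : Comparable L M) (u v : ℤ × ℤ) :
    ((withRoads L (18 * M)).dist u v : ℤ) = L.dist u v ∨
      ∃ a b, ((withRoads L (18 * M)).dist u v : ℤ) =
        L.dist u (scaled (18 * M) a) + roadDist a b + L.dist (scaled (18 * M) b) v := by
  obtain ⟨w, hw⟩ := (hL.withRoads_connected (18 * M)).exists_walk_length_eq_dist u v
  rw [← hw]
  rcases hL.walk_withRoads w with h | ⟨a, b, h⟩
  · exact Or.inl (le_antisymm (hw ▸ hL.withRoads_dist_le _ u v) h)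
  · exact Or.inr ⟨a, b, le_antisymm (hw ▸ hL.withRoads_dist_le_via u v a b) h⟩

lemma exists_dist_scaled_le (hL : Comparable L M) (u : ℤ × ℤ) :
    ∃ a, (L.dist u (scaled (18 * M) a) : ℤ) ≤ 108 * M := by
  obtain ⟨a, ha⟩ := exists_scaled_near (show 0 < 18 * M by linarith [hL.pos]) u
  exact ⟨a, by linarith [hL.dist_le u (scaled (18 * M) a)]⟩

lemma l1_le_of_dist_le (hL : Comparable L M) {u v : ℤ × ℤ} {r : ℤ} (h : (L.dist u v : ℤ) ≤ r) :
    l1 u v ≤ M * r :=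
  (hL.l1_le u v).trans (mul_le_mul_of_nonneg_left h hL.pos.le)

/-- Without roads only nearby points are reached by shortest paths. -/
lemma dist_le_of_withRoads_dist_eq (hL : Comparable L M) {u v : ℤ × ℤ}
    (h : ((withRoads L (18 * M)).dist u v : ℤ) = L.dist u v) :
    (L.dist u v : ℤ) ≤ 648 * M := by
  -- With `D = L.dist u v`, taking roads between nearby vertices gives `D ≤ 216 * M + (D + 216 * M)
  -- / 2`.
  obtain ⟨a, ha⟩ := hL.exists_dist_scaled_le u
  obtain ⟨b, hb⟩ := hL.exists_dist_scaled_le v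
  have h1 := hL.withRoads_dist_le_via u v a b
  have h2 := hL.roadDist_le_half a b
  have h3 := hL.dist_triangle (scaled (18 * M) a) u (scaled (18 * M) b)
  have h4 := hL.dist_triangle u v (scaled (18 * M) b)
  rw [SimpleGraph.dist_comm] at hb
  rw [SimpleGraph.dist_comm (u := v)] at h4
  rw [SimpleGraph.dist_comm (v := u)] at h3
  linarith

/-- Shortest paths enter the roads near their starting points. -/
lemma dist_le_of_via (hL : Comparable L M) {u v : ℤ × ℤ} {a b : RoadVertex}
    (h : ((withRoads L (18 * M)).dist u v : ℤ) =
      L.dist u (scaled (18 * M) a) + roadDist a b + L.dist (scaled (18 * M) b) v) :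
    (L.dist u (scaled (18 * M) a) : ℤ) ≤ 324 * M := by
  -- With `D` the distance in `L` from `u` to the entry, entering at the nearby `a'` instead gives
  -- `D ≤ 108 * M + (D + 108 * M) / 2`.
  obtain ⟨a', ha⟩ := hL.exists_dist_scaled_le u
  have h1 := hL.withRoads_dist_le_via u v a' b
  have h2 := roadDist_triangle a' a b
  have h3 := hL.roadDist_le_half a' a
  have h4 := hL.dist_triangle (scaled (18 * M) a') u (scaled (18 * M) a)
  rw [SimpleGraph.dist_comm (v := u)] at h4
  linarith

/-- If shortest paths from `q` to both ends use roads, then `q` is itself a road vertex: a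
nontrivial piece of `L` around `q` between the two roads would be shortened by a road taking at most
half the time. So `q` lies on a road geodesic between boundedly many entries near `u` and exits near
`v`. -/
lemma interval_subset (hL : Comparable L M) (u v : ℤ × ℤ) (k : ℤ) :
    {q | ((withRoads L (18 * M)).dist u q + (withRoads L (18 * M)).dist q v : ℤ) =
        (withRoads L (18 * M)).dist u v ∧ ((withRoads L (18 * M)).dist u q : ℤ) = k} ⊆
      {q | l1 u q ≤ M * (648 * M)} ∪ {q | l1 v q ≤ M * (648 * M)} ∪
        ⋃ a ∈ {a | l1 u (scaled (18 * M) a) ≤ M * (324 * M)},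
          ⋃ b ∈ {b | l1 v (scaled (18 * M) b) ≤ M * (324 * M)},
            scaled (18 * M) '' {c | roadDist a c + roadDist c b = roadDist a b ∧
              roadDist a c = k - L.dist u (scaled (18 * M) a)} := by
  rintro q ⟨h1, h2⟩
  rcases hL.withRoads_dist_eq u q with hu | ⟨a, b, hu⟩
  · exact Or.inl (Or.inl (hL.l1_le_of_dist_le (hL.dist_le_of_withRoads_dist_eq hu)))
  have hqv := hL.withRoads_dist_eq v q
  rw [SimpleGraph.dist_comm (u := v)] at hqv
  rcases hqv with hv | ⟨b', a', hv⟩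
  · rw [SimpleGraph.dist_comm] at hv
    exact Or.inl (Or.inr (hL.l1_le_of_dist_le (hL.dist_le_of_withRoads_dist_eq hv)))
  have na := hL.dist_le_of_via hu
  have nb := hL.dist_le_of_via ((congrArg Nat.cast SimpleGraph.dist_comm).trans hv)
  have t1 := hL.withRoads_dist_le_via u v a b'
  have t2 := roadDist_triangle a b b'
  have t3 := roadDist_triangle b a' b'
  have t4 := hL.roadDist_le_half b a'
  have t5 := hL.dist_triangle (scaled (18 * M) b) q (scaled (18 * M) a')
  rw [roadDist_comm b' a'] at hv
  rw [SimpleGraph.dist_comm (u := scaled (18 * M) b')] at t1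
  rw [SimpleGraph.dist_comm (u := q)] at t5
  have n1 : (0 : ℤ) ≤ L.dist (scaled (18 * M) b) q := Int.natCast_nonneg _
  have n2 : (0 : ℤ) ≤ L.dist (scaled (18 * M) a') q := Int.natCast_nonneg _
  have z1 : L.dist (scaled (18 * M) b) q = 0 := by
    have : (L.dist (scaled (18 * M) b) q : ℤ) = 0 := by linarith
    exact_mod_cast this
  have z2 : L.dist (scaled (18 * M) a') q = 0 := by
    have : (L.dist (scaled (18 * M) a') q : ℤ) = 0 := by linarith
    exact_mod_cast this
  have e1 := (hL.connected.dist_eq_zero_iff).1 z1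
  have e2 := (hL.connected.dist_eq_zero_iff).1 z2
  obtain rfl := hL.scaled_injective (e1.trans e2.symm)
  rw [z1] at hu
  rw [z2] at hv
  push_cast at hu hv
  right
  simp only [Set.mem_iUnion]
  exact ⟨a, hL.l1_le_of_dist_le na, b', hL.l1_le_of_dist_le nb, b,
    ⟨by linarith, by linarith⟩, e1⟩

lemma exists_encard_scaled_near_le (hL : Comparable L M) (r : ℤ) :
    ∃ B : ℕ, ∀ u, {a | l1 u (scaled (18 * M) a) ≤ r}.encard ≤ B := by
  obtain ⟨B, hB⟩ := exists_encard_ball_le r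
  refine ⟨B, fun u => ?_⟩
  rw [← hL.scaled_injective.encard_image]
  refine (Set.encard_le_encard ?_).trans (hB u)
  rintro _ ⟨a, ha, rfl⟩
  exact ha

lemma hasBoundedGeodesicSlices (hL : Comparable L M) :
    HasBoundedGeodesicSlices (withRoads L (18 * M)) := by
  obtain ⟨B, hB⟩ := exists_encard_ball_le (M * (648 * M))
  obtain ⟨N, hN⟩ := hL.exists_encard_scaled_near_le (M * (324 * M))
  obtain ⟨R, hR⟩ := exists_encard_road_le
  refine ⟨B + B + N * (N * R), fun u v k => ?_⟩
  have hsub : geodesicSlice (withRoads L (18 * M)) u v k ⊆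
      {q | ((withRoads L (18 * M)).dist u q + (withRoads L (18 * M)).dist q v : ℤ) =
        (withRoads L (18 * M)).dist u v ∧ ((withRoads L (18 * M)).dist u q : ℤ) = k} := by
    classical
    rintro q ⟨⟨p, hp, hq⟩, hk⟩
    refine ⟨?_, hk⟩
    have h1 := SimpleGraph.dist_le (p.takeUntil q hq)
    have h2 := SimpleGraph.dist_le (p.dropUntil q hq)
    have h3 := congrArg SimpleGraph.Walk.length (p.take_spec hq)
    rw [SimpleGraph.Walk.length_append] at h3
    have h4 := hL.withRoads_triangle (18 * M) u q v
    have h5 : p.length = (withRoads L (18 * M)).dist u v := hp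
    omega
  refine (Set.encard_le_encard (hsub.trans (hL.interval_subset u v k))).trans ?_
  refine (Set.encard_union_le _ _).trans ?_
  push_cast
  refine add_le_add ((Set.encard_union_le _ _).trans (add_le_add (hB u) (hB v))) ?_
  have := encard_biUnion_le_mul (hN u) fun a _ => encard_biUnion_le_mul (hN v) fun b _ =>
    (Set.encard_image_le (scaled (18 * M)) _).trans
      (hR a b (k - L.dist u (scaled (18 * M) a)))
  exact_mod_cast this

end Comparable

/-- Every bounded extension of the square lattice is geodesically directable. -/
lemma geodesicallyDirectable_of_isBoundedExtension {L : SimpleGraph (ℤ × ℤ)}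
    (hL : IsBoundedExtension L squareLattice) : GeodesicallyDirectable L := by
  obtain ⟨hle, M, hM⟩ := hL
  have hc := comparable_of_edist_le hle hM
  -- Road edges have ℓ¹ length at most 3 before scaling by `18 * (M + 1)`. The shift `M + 1` keeps
  -- the scale positive when `M = 0`.
  refine ⟨withRoads L (18 * (M + 1)), ⟨Comparable.le_withRoads _ _, 54 * (M + 1), ?_⟩,
    hc.hasBoundedGeodesicSlices⟩
  rintro u v (h | ⟨-, a, b, h, rfl, rfl⟩)
  · refine (SimpleGraph.edist_le (SimpleGraph.Walk.cons h .nil)).trans ?_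
    have : 1 ≤ 54 * (M + 1) := by omega
    exact_mod_cast this
  · refine (SimpleGraph.edist_anti hle).trans (squareLattice_edist_le ?_)
    rw [l1_scaled (by positivity)]
    have := l1_place_le_of_adj h
    push_cast
    nlinarith

end GeodesicSlices

theorem theorem1p3 (L : SimpleGraph (ℤ × ℤ))
    (hL : GeodesicSlices.IsBoundedExtension L GeodesicSlices.squareLattice) :
    GeodesicSlices.GeodesicallyDirectable L :=
  GeodesicSlices.geodesicallyDirectable_of_isBoundedExtension hL
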